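/- Let $G=(V,E)$ be a finite connected graph. For $x\in\mathbb R^V$ write $\operatorname{supp}_+(x)=\{v: x_v>0\}$, $\operatorname{supp}_-(x)=\{v: x_v<0\}$ and $\operatorname{supp}(x)=\{v:x_v\neq 0\}$; $G[S]$ is the subgraph induced by $S\subseteq V$, and $N(S)$ is the set of vertices outside $S$ adjacent to a vertex of $S$. A linear subspace $L\subseteq\mathbb R^V$ is a *semivalid representation* of $G$ if for every nonzero $x\in L$: (1) $\operatorname{supp}_+(x)$ and $\operatorname{supp}_-(x)$ are nonempty; (2) either $G[\operatorname{supp}_+(x)]$ is connected, or it has exactly two connected components and $G[\operatorname{supp}_-(x)]$ is connected; (3) if $\operatorname{supp}(x)$ is inclusion-minimal among supports of nonzero vectors of $L$, then $G[\operatorname{supp}_+(x)]$ and $G[\operatorname{supp}_-(x)]$ are nonempty and connected; (4) if $G[\operatorname{supp}_+(x)]$ is disconnected, then there is no edge between $\operatorname{supp}_+(x)$ and $\operatorname{supp}_-(x)$, and $N(C)=N(\operatorname{supp}(x))$ for every connected component $C$ of $G[\operatorname{supp}(x)]$. The fan $\mathcal P(L)$ consists of the relatively open cones that are the classes of $L$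 under the relation "$\operatorname{supp}_+(x)=\operatorname{supp}_+(y)$ and $\operatorname{supp}_-(x)=\operatorname{supp}_-(y)$". A cone of $\mathcal P(L)$ is *broken* if it consists of nonzero vectors $x$ with $G[\operatorname{supp}_+(x)]$ disconnected. For a polytope $P\subset L$ with the origin in its interior relative to $L$, faces of $P$ are taken relatively open, and $\mathcal F(P)$ is the fan of the relatively open cones over the nonempty proper faces of $P$, together with $\{0\}$. $P$ *subdivides* $\mathcal P(L)$ if $\mathcal F(P)$ and $\mathcal P(L)$ have the same union and each cone of $\mathcal F(P)$ is contained in a cone of $\mathcal P(L)$; then each nonempty proper face $F$ of $P$ lies in a unique cone $\gamma(F)\in\mathcal P(L)$. **Proposition.** For every semivalid representation $L$ of $G$ there is a *polytopal representation*, that is, a polytope $P\subset L$ containing the origin in its interior relative to $L$ such that (i) the vertex set of $P$ is centrally symmetric; (ii) $P$ subdivides $\mathcal P(L)$; (iii) $P$ is simplicial, that is, all its proper faces are simplices; (iv) if $E$ and $F$ are nonempty faces of a common proper face of $P$, then $\gamma(E)$ is a face of $\gamma(F)$ or $\gamma(F)$ is a face of $\gamma(E)$ (possibly $\gamma(E)=\gamma(F)$);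 (v) for every vertex $a$ of $P$, all edges of the boundary complex $\partial P$ that lie in broken cones of $\mathcal P(L)$ and belong to the closed star of $a$ in $\partial P$ (the faces of $\partial P$ contained in the closure of some proper face whose closure contains $a$) lie in the same broken cone. -/

import Mathlib

namespace Semivalid

open Set

/-- The positive support of a vector. -/
def suppPos {V : Type*} (x : V → ℝ) : Set V := {v | 0 < x v}

/-- The negative support of a vector. -/
def suppNeg {V : Type*} (x : V → ℝ) : Set V := {v | x v < 0}

/-- `N(S)`: the vertices outside `S` that are adjacent to a vertex of `S`. -/
def nbhd {V : Type*} (G : SimpleGraph V) (S : Set V) : Set V :=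
  {v | v ∉ S ∧ ∃ u ∈ S, G.Adj u v}

/-- Semivalid representations `L ⊆ ℝ^V` of a connected graph `G`. -/
structure IsSemivalid {V : Type*} (G : SimpleGraph V) (L : Submodule ℝ (V → ℝ)) : Prop where
  nonempty : ∀ x ∈ L, x ≠ 0 → (suppPos x).Nonempty ∧ (suppNeg x).Nonempty
  components : ∀ x ∈ L, x ≠ 0 →
    (G.induce (suppPos x)).Connected ∨
      (Nat.card (G.induce (suppPos x)).ConnectedComponent = 2 ∧
        (G.induce (suppNeg x)).Connected)
  minimal : ∀ x ∈ L, x ≠ 0 →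
    (∀ y ∈ L, y ≠ 0 → Function.support y ⊆ Function.support x →
      Function.support y = Function.support x) →
    (G.induce (suppPos x)).Connected ∧ (G.induce (suppNeg x)).Connected
  separation : ∀ x ∈ L, x ≠ 0 → ¬ (G.induce (suppPos x)).Preconnected →
    (∀ u ∈ suppPos x, ∀ v ∈ suppNeg x, ¬ G.Adj u v) ∧
      ∀ C : (G.induce (Function.support x)).ConnectedComponent,
        nbhd G (Subtype.val '' C.supp) = nbhd G (Function.support x)

/-- The relatively open cone of all vectors of `L` with the same sign pattern as `x`. -/
def signCone {V : Type*} (L : Submodule ℝ (V → ℝ)) (x : V → ℝ) : Set (V → ℝ) :=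
  {y | y ∈ L ∧ suppPos y = suppPos x ∧ suppNeg y = suppNeg x}

/-- The fan `𝒫(L)`, as its collection of relatively open cones. -/
def signFan {V : Type*} (L : Submodule ℝ (V → ℝ)) : Set (Set (V → ℝ)) :=
  {α | ∃ x ∈ L, α = signCone L x}

/-- A vector is broken if it is nonzero and its positive support induces a disconnected graph. -/
def IsBrokenVector {V : Type*} (G : SimpleGraph V) (x : V → ℝ) : Prop :=
  x ≠ 0 ∧ ¬ (G.induce (suppPos x)).Preconnected

/-- Broken cones: the cones of `𝒫(L)` consisting of broken vectors. -/
def IsBrokenCone {V : Type*} (G : SimpleGraph V) (L : Submodule ℝ (V → ℝ))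
    (β : Set (V → ℝ)) : Prop :=
  β ∈ signFan L ∧ ∀ x ∈ β, IsBrokenVector G x

section Polytopes

variable {E : Type*} [AddCommGroup E] [Module ℝ E] [TopologicalSpace E]

/-- A (closed) polytope: the convex hull of a finite set of points. -/
def IsPolytope (P : Set E) : Prop := ∃ s : Finset E, P = convexHull ℝ (s : Set E)

/-- `F` is a nonempty closed face of the closed convex set `P`, cut out by a supporting
hyperplane (`F = P` is allowed). -/
def IsFace (P F : Set E) : Prop := IsExposed ℝ P F ∧ F.Nonempty

/-- The nonempty proper closed faces of `P`, that is, the nonempty faces of `∂P`. -/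
def IsProperFace (P F : Set E) : Prop := IsFace P F ∧ F ≠ P

/-- A closed simplex. -/
def IsSimplex (F : Set E) : Prop :=
  ∃ s : Finset E, AffineIndependent ℝ (Subtype.val : s → E) ∧ F = convexHull ℝ (s : Set E)

/-- The relatively open cone `⋃_{r > 0} r • relint F` over the relative interior of `F`. -/
def openCone (F : Set E) : Set E := {y | ∃ r : ℝ, 0 < r ∧ ∃ x ∈ intrinsicInterior ℝ F, y = r • x}

/-- The fan `ℱ(P)` of a polytope `P` with the origin in its interior: the relatively open cones
over the nonempty proper faces, and the origin (the cone over the empty face). -/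
def faceFan (P : Set E) : Set (Set E) := {α | α = {0} ∨ ∃ F, IsProperFace P F ∧ α = openCone F}

/-- `𝒟` subdivides `𝒞` (collections of relatively open polyhedra): the bodies agree, and every
member of `𝒟` is contained in a member of `𝒞`. -/
def Subdivides (𝒟 𝒞 : Set (Set E)) : Prop := ⋃₀ 𝒟 = ⋃₀ 𝒞 ∧ ∀ η ∈ 𝒟, ∃ τ ∈ 𝒞, η ⊆ τ

/-- For relatively open polyhedra: `η` is a face of `τ`. -/
def IsOpenFace (τ η : Set E) : Prop := IsFace (closure τ) (closure η)

/-- An edge of `∂P`: a proper face of dimension one. -/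
def IsEdge (P F : Set E) : Prop := IsProperFace P F ∧ Module.finrank ℝ (vectorSpan ℝ F) = 1

/-- `F` belongs to the closed star of the vertex `a` in the complex `∂P`. -/
def InStar (P : Set E) (a : E) (F : Set E) : Prop :=
  IsProperFace P F ∧ ∃ T, IsProperFace P T ∧ a ∈ T ∧ F ⊆ T

end Polytopes

/-- `α = γ(F)`: the cone `α` of `𝒫(L)` contains the (relatively open) face given by `F`. -/
def IsCarrier {V : Type*} (L : Submodule ℝ (V → ℝ)) (F α : Set (V → ℝ)) : Prop :=
  α ∈ signFan L ∧ intrinsicInterior ℝ F ⊆ α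

/-- Polytopal representations `P ⊆ L` of `G`, for a semivalid representation `L`. -/
structure IsPolytopalRepresentation {V : Type*} (G : SimpleGraph V) (L : Submodule ℝ (V → ℝ))
    (P : Set (V → ℝ)) : Prop where
  polytope : IsPolytope P
  subset : P ⊆ (L : Set (V → ℝ))
  zero_mem_interior : (0 : L) ∈ interior (Subtype.val ⁻¹' P : Set L)
  symmetric : ∀ a ∈ P.exposedPoints ℝ, -a ∈ P.exposedPoints ℝ
  subdivides : Subdivides (faceFan P) (signFan L)
  simplicial : ∀ F, IsProperFace P F → IsSimplex F
  chain : ∀ E F H, IsProperFace P E → IsProperFace P F → IsProperFace P H →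
    IsFace H E → IsFace H F →
    ∀ α β, IsCarrier L E α → IsCarrier L F β → IsOpenFace β α ∨ IsOpenFace α β
  broken : ∀ a ∈ P.exposedPoints ℝ, ∀ E F, IsEdge P E → IsEdge P F →
    InStar P a E → InStar P a F →
    ∀ α β, IsBrokenCone G L α → IsBrokenCone G L β → IsCarrier L E α → IsCarrier L F β → α = β

end Semivalid

/-! The polytope is a perturbed unit ball of a norm on `L`. Take all linear forms `x_u - 2 s x_v`
with `s ∈ {-1, 0, 1}` (`signForm`) and let `N` be the sum of their absolute values. If a form has
opposite strict signs at `x` and `y`, then `N (x + y) < N x + N y`; hence no form takes both signs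
on a proper face of the ball `N ≤ 1`. Dividing each vertex `a` by a generic height `μ_a = μ_{-a}`
near `1` makes the ball simplicial and keeps it symmetric, and the strict inequality survives the
perturbation (`exists_simplicial_points`). So every proper face is `Coherent`.

Coherence gives the rest of the polyhedral structure. The forms with `s = 0` are the coordinates, so
each open face lies in one sign cone. The forms with `s = ±1` force the supports of two points of a
common proper face to be nested, which makes carriers comparable (`Coherent.conforms_or`). The
factor `2` serves the star condition: if `e` and `f` each share a proper face with `a`, then `a`
conforms to both, or one of `e`, `f` conforms to the other (`Coherent.exists_common`). In each case
the closures of the cones of `e` and `f` share a nonzero vector.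

It remains to see that two broken cones whose closures share a nonzero vector coincide
(`IsSemivalid.broken_unique`). This is graph theory: a minimal vector `z` conforming to a broken `x`
has the full negative support of `x` and a whole component of its positive support
(`IsSemivalid.minimal_conforms_broken`). If `z` lies below two different broken vectors `x` and
`x'`, then `x + x'` has a positive support with at least three components. -/

namespace Semivalid

open Set

/-! ### Components of induced subgraphs. -/

section Graph

variable {V : Type*} {G : SimpleGraph V}

/-- A vertex set closed under adjacency within `S` is closed under reachability within `S`. -/
lemma mem_of_reachable {S A : Set V} (hA : ∀ a ∈ A, ∀ b ∈ S, G.Adj a b → b ∈ A) {u v : S}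
    (h : (G.induce S).Reachable u v) (hu : (u : V) ∈ A) : (v : V) ∈ A := by
  obtain ⟨w⟩ := h
  induction w with
  | nil => exact hu
  | cons hadj _ ih => exact ih (hA _ hu _ (Subtype.coe_prop _) hadj)

lemma subset_of_preconnected {S A : Set V} (hS : (G.induce S).Preconnected)
    (hA : ∀ a ∈ A, ∀ b ∈ S, G.Adj a b → b ∈ A) {u : V} (huS : u ∈ S) (huA : u ∈ A) : S ⊆ A :=
  fun v hv => mem_of_reachable (u := ⟨u, huS⟩) (v := ⟨v, hv⟩) hA (hS _ _) huA

/-- Three pairwise separated vertices cannot lie in a graph with two components. -/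
lemma not_card_connectedComponent_eq_two {S A B : Set V}
    (hA : ∀ a ∈ A, ∀ b ∈ S, G.Adj a b → b ∈ A) (hB : ∀ a ∈ B, ∀ b ∈ S, G.Adj a b → b ∈ B)
    {u v w : V} (hu : u ∈ S) (hv : v ∈ S) (hw : w ∈ S) (huA : u ∈ A) (hvA : v ∉ A) (hwA : w ∉ A)
    (hvB : v ∈ B) (hwB : w ∉ B) : Nat.card (G.induce S).ConnectedComponent ≠ 2 := by
  intro hcard
  obtain ⟨a, b, -, hab⟩ := Nat.card_eq_two_iff.1 hcard
  have key : ∀ c : (G.induce S).ConnectedComponent, c = a ∨ c = b := by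
    intro c
    have : c ∈ ({a, b} : Set _) := hab ▸ mem_univ c
    simpa using this
  have huv : (G.induce S).connectedComponentMk ⟨u, hu⟩ ≠ (G.induce S).connectedComponentMk ⟨v, hv⟩ :=
    fun h => hvA (mem_of_reachable hA (SimpleGraph.ConnectedComponent.eq.1 h) huA)
  have huw : (G.induce S).connectedComponentMk ⟨u, hu⟩ ≠ (G.induce S).connectedComponentMk ⟨w, hw⟩ :=
    fun h => hwA (mem_of_reachable hA (SimpleGraph.ConnectedComponent.eq.1 h) huA)
  have hvw : (G.induce S).connectedComponentMk ⟨v, hv⟩ ≠ (G.induce S).connectedComponentMk ⟨w, hw⟩ :=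
    fun h => hwB (mem_of_reachable hB (SimpleGraph.ConnectedComponent.eq.1 h) hvB)
  rcases key ((G.induce S).connectedComponentMk ⟨u, hu⟩) with h1 | h1 <;>
  rcases key ((G.induce S).connectedComponentMk ⟨v, hv⟩) with h2 | h2 <;>
  rcases key ((G.induce S).connectedComponentMk ⟨w, hw⟩) with h3 | h3 <;>
  first
    | exact huv (h1.trans h2.symm)
    | exact huw (h1.trans h3.symm)
    | exact hvw (h2.trans h3.symm)

lemma exists_connectedComponent_image_eq {S A : Set V} (hAS : A ⊆ S) (hconn : (G.induce A).Connected)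
    (hA : ∀ a ∈ A, ∀ b ∈ S, G.Adj a b → b ∈ A) :
    ∃ C : (G.induce S).ConnectedComponent, Subtype.val '' C.supp = A := by
  obtain ⟨⟨u, hu⟩⟩ := hconn.nonempty
  refine ⟨(G.induce S).connectedComponentMk ⟨u, hAS hu⟩, ?_⟩
  ext v
  constructor
  · rintro ⟨w, hw, rfl⟩
    exact mem_of_reachable hA (SimpleGraph.ConnectedComponent.eq.1 hw).symm hu
  · intro hv
    refine ⟨⟨v, hAS hv⟩, ?_, rfl⟩
    refine SimpleGraph.ConnectedComponent.eq.2 ?_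
    exact (hconn.preconnected ⟨v, hv⟩ ⟨u, hu⟩).map (SimpleGraph.induceHomOfLE G hAS).toHom

end Graph

/-! ### Conforming vectors of minimal support. -/

section Conform

variable {V : Type*}

/-- `y` conforms to `x`: the sign pattern of `y` is obtained from that of `x` by replacing some
signs by zero. -/
def Conforms (y x : V → ℝ) : Prop := suppPos y ⊆ suppPos x ∧ suppNeg y ⊆ suppNeg x

lemma Conforms.refl (x : V → ℝ) : Conforms x x := ⟨Subset.rfl, Subset.rfl⟩

lemma Conforms.trans {x y z : V → ℝ} (h : Conforms x y) (h' : Conforms y z) : Conforms x z :=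
  ⟨h.1.trans h'.1, h.2.trans h'.2⟩

lemma Conforms.support_subset {x y : V → ℝ} (h : Conforms y x) :
    Function.support y ⊆ Function.support x := by
  intro v hv
  rcases lt_or_gt_of_ne (Function.mem_support.1 hv) with h1 | h1
  · exact (show x v < 0 from h.2 h1).ne
  · exact (show 0 < x v from h.1 h1).ne'

lemma mem_suppPos {x : V → ℝ} {v : V} : v ∈ suppPos x ↔ 0 < x v := Iff.rfl

lemma mem_suppNeg {x : V → ℝ} {v : V} : v ∈ suppNeg x ↔ x v < 0 := Iff.rfl

/-- Below every nonzero vector of `L` there is a conforming vector of minimal support. -/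
lemma exists_conforms_minimal [Finite V] (L : Submodule ℝ (V → ℝ)) {y : V → ℝ} (hy : y ∈ L)
    (hy0 : y ≠ 0) : ∃ z ∈ L, z ≠ 0 ∧ Conforms z y ∧
      ∀ w ∈ L, w ≠ 0 → Function.support w ⊆ Function.support z →
        Function.support w = Function.support z := by
  classical
  have hfin : {S : Set V | ∃ z ∈ L, z ≠ 0 ∧ Conforms z y ∧ Function.support z = S}.Finite :=
    Set.toFinite _
  obtain ⟨S, ⟨z, hz, hz0, hzy, rfl⟩, hmin⟩ :=
    hfin.exists_minimal ⟨_, y, hy, hy0, Conforms.refl y, rfl⟩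
  refine ⟨z, hz, hz0, hzy, fun w hw hw0 hwz => ?_⟩
  by_contra hne
  obtain ⟨v0, hv0z, hv0w⟩ := Set.exists_of_ssubset (hwz.ssubset_of_ne hne)
  -- Elimination: subtract from `z` the largest multiple of `w` that preserves conformity. This
  -- kills a coordinate where the signs agree, while `v0`, where `w` vanishes, keeps the difference
  -- nonzero.
  have main : ∀ w ∈ L, Function.support w ⊆ Function.support z → w v0 = 0 →
      (∃ v, 0 < w v * z v) → False := by
    intro w hw hwz hwv0 hex
    obtain ⟨v1, hv1, hle⟩ := Set.exists_min_image {v | 0 < w v * z v} (fun v => z v / w v)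
      (Set.toFinite _) hex
    have hv1' : 0 < w v1 * z v1 := hv1
    have hw1 : w v1 ≠ 0 := by rintro h; simp [h] at hv1'
    set t := z v1 / w v1 with ht
    have htpos : 0 < t := by
      have : t = (w v1 * z v1) / (w v1 * w v1) := by rw [ht]; field_simp
      rw [this]; exact div_pos hv1' (mul_self_pos.2 hw1)
    have hval : ∀ v, (z - t • w) v = z v - t * w v := fun v => by simp
    have hconf : Conforms (z - t • w) z := by
      constructor
      · intro v hv
        rw [mem_suppPos, hval] at hv
        rw [mem_suppPos]
        by_contra hz'
        have hwneg : w v < 0 := by nlinarith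
        have hzv : z v ≠ 0 := hwz hwneg.ne
        have hzneg : z v < 0 := lt_of_le_of_ne (not_lt.1 hz') hzv
        have h2 := hle v (mul_pos_of_neg_of_neg hwneg hzneg)
        have h3 : t ≤ z v / w v := h2
        rw [le_div_iff_of_neg hwneg] at h3
        linarith
      · intro v hv
        rw [mem_suppNeg, hval] at hv
        rw [mem_suppNeg]
        by_contra hz'
        have hwpos : 0 < w v := by nlinarith
        have hzv : z v ≠ 0 := hwz hwpos.ne'
        have hzpos : 0 < z v := lt_of_le_of_ne (not_lt.1 hz') hzv.symm
        have h3 : t ≤ z v / w v := hle v (mul_pos hwpos hzpos)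
        rw [le_div_iff₀ hwpos] at h3
        linarith
    have hne0 : z - t • w ≠ 0 := by
      intro h
      have := congrFun h v0
      rw [hval, hwv0] at this
      exact hv0z (by simpa using this)
    have hsub := hmin ⟨z - t • w, L.sub_mem hz (L.smul_mem t hw), hne0, hconf.trans hzy, rfl⟩
      hconf.support_subset
    have hv1z : v1 ∈ Function.support z := by
      rintro h; simp [h] at hv1'
    have := hsub hv1z
    rw [Function.mem_support, hval, ht] at this
    apply this
    field_simp
    simp
  obtain ⟨v, hv⟩ := Function.ne_iff.1 hw0
  have hwz' : w v * z v ≠ 0 := mul_ne_zero hv (hwz hv)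
  -- One of `w` and `-w` agrees in sign with `z` at `v`.
  rcases lt_or_gt_of_ne hwz' with h | h
  · refine main (-w) (L.neg_mem hw) (by simpa using hwz) (by simpa using hv0w) ⟨v, ?_⟩
    simp only [Pi.neg_apply]; linarith
  · exact main w hw hwz (by simpa using hv0w) ⟨v, h⟩

end Conform

/-! ### Rigidity of broken vectors. -/

section Broken

variable {V : Type*} {G : SimpleGraph V} {L : Submodule ℝ (V → ℝ)}

/-- A vector of minimal support conforming to a broken vector `x` has the same negative support as
`x`, and its positive support is a component of the positive support of `x`. -/
lemma IsSemivalid.minimal_conforms_broken [Finite V] (hL : IsSemivalid G L) {x y : V → ℝ} (hx : x ∈ L)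
    (hb : IsBrokenVector G x) (hy : y ∈ L) (hy0 : y ≠ 0) (hyx : Conforms y x)
    (hconn : (G.induce (suppPos y)).Connected) :
    suppNeg y = suppNeg x ∧ (∀ a ∈ suppPos y, ∀ b ∈ suppPos x, G.Adj a b → b ∈ suppPos y) ∧
      ∃ c ∈ suppPos x, c ∉ suppPos y := by
  obtain ⟨hsep, -⟩ := hL.separation x hx hb.1 hb.2
  have hsep' : ∀ u ∈ suppNeg x, ∀ v ∈ suppPos x, ¬ G.Adj u v := fun u hu v hv h =>
    hsep v hv u hu h.symm
  obtain ⟨⟨y0, hy0p⟩, ⟨y1, hy1⟩⟩ := hL.nonempty y hy hy0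
  -- So large that on the support of `y` the vector `x - t • y` has the sign of `-y`; condition (2)
  -- is then applied to this vector.
  obtain ⟨t, htpos, ht⟩ : ∃ t : ℝ, 0 < t ∧ ∀ v, y v ≠ 0 → |x v| < t * |y v| := by
    obtain ⟨M, hM⟩ := (Set.finite_range fun v => |x v| / |y v|).bddAbove
    refine ⟨max M 0 + 1, by positivity, fun v hv => ?_⟩
    have h1 : |x v| / |y v| ≤ M := hM ⟨v, rfl⟩
    have h2 : |x v| / |y v| < max M 0 + 1 := by linarith [le_max_left M 0]
    rwa [div_lt_iff₀ (abs_pos.2 hv)] at h2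
  have hval : ∀ v, (x - t • y) v = x v - t * y v := fun v => by simp
  have hpos : suppPos (x - t • y) = (suppPos x \ suppPos y) ∪ suppNeg y := by
    ext v
    simp only [mem_union, mem_sdiff, mem_suppPos, mem_suppNeg, hval]
    rcases lt_trichotomy (y v) 0 with h | h | h
    · have := ht v h.ne
      rw [abs_of_neg h] at this
      have := neg_abs_le (x v)
      constructor
      · intro; right; exact h
      · intro; linarith
    · simp [h]
    · have := ht v h.ne'
      rw [abs_of_pos h] at this
      have := le_abs_self (x v)
      constructor
      · intro; linarith
      · rintro (h1 | h1)
        · exact absurd h h1.2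
        · linarith
  have hneg : suppNeg (x - t • y) = suppPos y ∪ (suppNeg x \ suppNeg y) := by
    ext v
    simp only [mem_union, mem_sdiff, mem_suppPos, mem_suppNeg, hval]
    rcases lt_trichotomy (y v) 0 with h | h | h
    · have := ht v h.ne
      rw [abs_of_neg h] at this
      have := neg_abs_le (x v)
      constructor
      · intro; linarith
      · rintro (h1 | h1)
        · linarith
        · exact absurd h h1.2
    · simp [h]
    · have := ht v h.ne'
      rw [abs_of_pos h] at this
      have := le_abs_self (x v)
      constructor
      · intro; left; exact h
      · intro; linarith
  have hwL : x - t • y ∈ L := L.sub_mem hx (L.smul_mem t hy)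
  have hw0 : x - t • y ≠ 0 := by
    intro h
    have : y1 ∈ suppPos (x - t • y) := by rw [hpos]; exact Or.inr hy1
    rw [h] at this
    exact lt_irrefl (0 : ℝ) this
  have hnegclosed : ∀ a ∈ suppNeg y, ∀ b ∈ suppPos (x - t • y), G.Adj a b → b ∈ suppNeg y := by
    intro a ha b hb' hab
    rw [hpos] at hb'
    rcases hb' with hb' | hb'
    · exact absurd hab (hsep' a (hyx.2 ha) b hb'.1)
    · exact hb'
  -- the component of `suppPos x` that contains `suppPos y`
  let C : Set V := {v | ∃ h : v ∈ suppPos x, (G.induce (suppPos x)).Reachable ⟨y0, hyx.1 hy0p⟩ ⟨v, h⟩}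
  have hCclosed : ∀ a ∈ C, ∀ b ∈ suppPos x, G.Adj a b → b ∈ C := by
    rintro a ⟨ha, har⟩ b hb' hab
    exact ⟨hb', har.trans (SimpleGraph.Adj.reachable (by exact hab))⟩
  have hyC : suppPos y ⊆ C :=
    subset_of_preconnected hconn.preconnected (fun a ha b hb' => hCclosed a ha b (hyx.1 hb')) hy0p
      ⟨hyx.1 hy0p, SimpleGraph.Reachable.refl _⟩
  obtain ⟨c, hcx, hcC⟩ : ∃ c ∈ suppPos x, c ∉ C := by
    by_contra! h
    refine hb.2 fun u v => ?_
    obtain ⟨_, hu⟩ := h u u.2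
    obtain ⟨_, hv⟩ := h v v.2
    exact hu.symm.trans hv
  have hc : c ∈ suppPos (x - t • y) := by rw [hpos]; exact Or.inl ⟨hcx, fun h => hcC (hyC h)⟩
  have hposneg : ∀ v ∈ suppPos x, v ∉ suppNeg y := fun v hv hv' =>
    lt_asymm (show 0 < x v from hv) (hyx.2 hv')
  have hcn : c ∉ suppNeg y := hposneg c hcx
  have hy1w : y1 ∈ suppPos (x - t • y) := by rw [hpos]; exact Or.inr hy1
  -- `suppNeg y` is separated from `c`, so exactly two components remain and the negative support
  -- must be connected.
  have hnc : ¬ (G.induce (suppPos (x - t • y))).Connected := fun h =>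
    hcn (subset_of_preconnected h.preconnected hnegclosed hy1w hy1 hc)
  obtain ⟨hcard, hnegconn⟩ := (hL.components _ hwL hw0).resolve_left hnc
  have hCy : C ⊆ suppPos y := by
    intro d hd
    by_contra hdy
    have hdw : d ∈ suppPos (x - t • y) := by rw [hpos]; exact Or.inl ⟨hd.1, hdy⟩
    -- A point of `C` outside `suppPos y` would give a third part, besides `suppNeg y` and the
    -- component of `c`.
    refine not_card_connectedComponent_eq_two (A := suppNeg y) (B := C \ suppPos y) hnegclosed ?_
      hy1w hdw hc hy1 (hposneg d hd.1) hcn ⟨hd, hdy⟩ (fun h => hcC h.1) hcard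
    intro a ha b hb' hab
    rw [hpos] at hb'
    rcases hb' with hb' | hb'
    · exact ⟨hCclosed a ha.1 b hb'.1 hab, hb'.2⟩
    · exact absurd hab (hsep a ha.1.1 b (hyx.2 hb'))
  refine ⟨Subset.antisymm hyx.2 ?_, ?_, c, hcx, fun h => hcC (hyC h)⟩
  · intro v hv
    by_contra hvy
    have hvw : v ∈ suppNeg (x - t • y) := by rw [hneg]; exact Or.inr ⟨hv, hvy⟩
    have hy0w : y0 ∈ suppNeg (x - t • y) := by rw [hneg]; exact Or.inl hy0p
    have : v ∈ suppPos y := by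
      -- No edge joins the two supports of `x`, so the connected set `suppNeg (x - t • y)` cannot
      -- exceed `suppPos y`.
      refine subset_of_preconnected hnegconn.preconnected ?_ hy0w hy0p hvw
      intro a ha b hb' hab
      rw [hneg] at hb'
      rcases hb' with hb' | hb'
      · exact hb'
      · exact absurd hab (hsep a (hyx.1 ha) b hb'.1)
    exact lt_asymm (show x v < 0 from hv) (hyx.1 this)
  · intro a ha b hb' hab
    exact hCy (hCclosed a (hyC ha) b hb' hab)

lemma support_eq_union (x : V → ℝ) : Function.support x = suppPos x ∪ suppNeg x := by
  ext v
  simp only [Function.mem_support, mem_union, mem_suppPos, mem_suppNeg]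
  constructor
  · intro h; exact (lt_or_gt_of_ne h).symm
  · rintro (h | h)
    · exact h.ne'
    · exact h.ne

/-- Two broken cones whose closures share a nonzero vector have the same sign pattern. -/
lemma IsSemivalid.broken_unique [Finite V] (hL : IsSemivalid G L) {x x' y : V → ℝ} (hx : x ∈ L)
    (hb : IsBrokenVector G x) (hx' : x' ∈ L) (hb' : IsBrokenVector G x') (hy : y ∈ L) (hy0 : y ≠ 0)
    (hyx : Conforms y x) (hyx' : Conforms y x') :
    suppPos x = suppPos x' ∧ suppNeg x = suppNeg x' := by
  obtain ⟨z, hz, hz0, hzy, hmin⟩ := exists_conforms_minimal L hy hy0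
  obtain ⟨hconn, -⟩ := hL.minimal z hz hz0 hmin
  have hne : suppNeg x = suppNeg x' :=
    (hL.minimal_conforms_broken hx hb hz hz0 (hzy.trans hyx) hconn).1.symm.trans
      (hL.minimal_conforms_broken hx' hb' hz hz0 (hzy.trans hyx') hconn).1
  have hN : ∀ {x : V → ℝ}, x ∈ L → IsBrokenVector G x → Conforms z x →
      nbhd G (suppPos z) = nbhd G (Function.support x) := by
    intro x hx hb hzx
    obtain ⟨-, hcl, -⟩ := hL.minimal_conforms_broken hx hb hz hz0 hzx hconn
    obtain ⟨hsep, hnb⟩ := hL.separation x hx hb.1 hb.2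
    obtain ⟨C, hC⟩ := exists_connectedComponent_image_eq (S := Function.support x) (A := suppPos z)
      (by rw [support_eq_union]; exact hzx.1.trans subset_union_left) hconn (by
        intro a ha b hb' hab
        rw [support_eq_union] at hb'
        rcases hb' with hb' | hb'
        · exact hcl a ha b hb' hab
        · exact absurd hab (hsep a (hzx.1 ha) b hb'))
    rw [← hC, hnb C]
  have hsub : ∀ {x x' : V → ℝ}, x ∈ L → IsBrokenVector G x → x' ∈ L → IsBrokenVector G x' →
      Conforms z x → Conforms z x' → suppNeg x = suppNeg x' → suppPos x ⊆ suppPos x' := by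
    intro x x' hx hb hx' hb' hzx hzx' hne v hv
    by_contra hvx'
    obtain ⟨-, hcl, -⟩ := hL.minimal_conforms_broken hx hb hz hz0 hzx hconn
    obtain ⟨-, hcl', c, hc, hcz⟩ := hL.minimal_conforms_broken hx' hb' hz hz0 hzx' hconn
    obtain ⟨⟨z0, hz0p⟩, -⟩ := hL.nonempty z hz hz0
    have hNN : nbhd G (Function.support x) = nbhd G (Function.support x') :=
      (hN hx hb hzx).symm.trans (hN hx' hb' hzx')
    -- The negative supports agree, so no positive entry is cancelled.
    have hpos : suppPos (x + x') = suppPos x ∪ suppPos x' := by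
      ext v
      have h1 : x v < 0 ↔ x' v < 0 := by rw [← mem_suppNeg, hne, mem_suppNeg]
      simp only [mem_union, mem_suppPos, Pi.add_apply]
      constructor
      · intro h
        by_contra! hcon
        linarith [hcon.1, hcon.2]
      · rintro (h | h)
        · have : 0 ≤ x' v := by by_contra! h2; linarith [h1.2 h2]
          linarith
        · have : 0 ≤ x v := by by_contra! h2; linarith [h1.1 h2]
          linarith
    have hclosed : ∀ a ∈ suppPos z, ∀ b ∈ suppPos (x + x'), G.Adj a b → b ∈ suppPos z := by
      intro a ha b hb hab
      rw [hpos] at hb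
      rcases hb with hb | hb
      · exact hcl a ha b hb hab
      · exact hcl' a ha b hb hab
    have hz0w : z0 ∈ suppPos (x + x') := by rw [hpos]; exact Or.inl (hzx.1 hz0p)
    have hcw : c ∈ suppPos (x + x') := by rw [hpos]; exact Or.inr hc
    have hvw : v ∈ suppPos (x + x') := by rw [hpos]; exact Or.inl hv
    have hne0 : x + x' ≠ 0 := by
      intro h
      rw [h] at hcw
      exact lt_irrefl (0 : ℝ) hcw
    have hnc : ¬ (G.induce (suppPos (x + x'))).Connected := fun h =>
      hcz (subset_of_preconnected h.preconnected hclosed hz0w hz0p hcw)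
    obtain ⟨hcard, -⟩ := (hL.components _ (L.add_mem hx hx') hne0).resolve_left hnc
    -- The three parts are `suppPos z`, the rest of `suppPos x'` (containing `c`), and the
    -- complement of `suppPos x'` (containing `v`).
    refine not_card_connectedComponent_eq_two (A := suppPos z) (B := suppPos x') hclosed ?_
      hz0w hcw hvw hz0p hcz (fun h => hvx' (hzx'.1 h)) hc hvx' hcard
    intro a ha b hb hab
    rw [hpos] at hb
    rcases hb with hb | hb
    · by_contra hbx'
      have hbs : b ∉ Function.support x' := by
        rw [support_eq_union, ← hne]
        rintro (h | h)
        · exact hbx' h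
        · exact lt_asymm (show x b < 0 from h) hb
      have : b ∈ nbhd G (Function.support x) := by
        rw [hNN]
        exact ⟨hbs, a, by rw [support_eq_union]; exact Or.inl ha, hab⟩
      exact this.1 (show x b ≠ 0 from (show 0 < x b from hb).ne')
    · exact hb
  exact ⟨Subset.antisymm (hsub hx hb hx' hb' (hzy.trans hyx) (hzy.trans hyx') hne)
    (hsub hx' hb' hx hb (hzy.trans hyx') (hzy.trans hyx) hne.symm), hne⟩

end Broken

/-! ### The unit ball of a sum of absolute values of linear forms. -/

section AbsSum

open Filter Topology

variable {F : Type*} [NormedAddCommGroup F] [NormedSpace ℝ F]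
  {κ : Type*} [Fintype κ]

/-- The sum of the absolute values of finitely many linear forms. -/
def absSum (h : κ → F →ₗ[ℝ] ℝ) (x : F) : ℝ := ∑ k, |h k x|

variable (h : κ → F →ₗ[ℝ] ℝ)

lemma absSum_nonneg (x : F) : 0 ≤ absSum h x := Finset.sum_nonneg fun _ _ => abs_nonneg _

lemma absSum_smul (t : ℝ) (x : F) : absSum h (t • x) = |t| * absSum h x := by
  simp [absSum, abs_mul, Finset.mul_sum]

lemma absSum_neg (x : F) : absSum h (-x) = absSum h x := by simp [absSum]

lemma absSum_add_le (x y : F) : absSum h (x + y) ≤ absSum h x + absSum h y := by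
  rw [absSum, absSum, absSum, ← Finset.sum_add_distrib]
  exact Finset.sum_le_sum fun k _ => by rw [map_add]; exact abs_add_le _ _

lemma abs_add_lt_of_mul_neg {a b : ℝ} (hab : a * b < 0) : |a + b| < |a| + |b| := by
  rcases mul_neg_iff.1 hab with ⟨h1, h2⟩ | ⟨h1, h2⟩
  · rw [abs_of_pos h1, abs_of_neg h2, abs_lt]; constructor <;> linarith
  · rw [abs_of_neg h1, abs_of_pos h2, abs_lt]; constructor <;> linarith

/-- This strictness is what keeps the faces of the ball from crossing the hyperplanes of the forms.
-/
lemma absSum_add_lt {x y : F} {k : κ} (hk : h k x * h k y < 0) :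
    absSum h (x + y) < absSum h x + absSum h y := by
  rw [absSum, absSum, absSum, ← Finset.sum_add_distrib]
  refine Finset.sum_lt_sum (fun k _ => by rw [map_add]; exact abs_add_le _ _)
    ⟨k, Finset.mem_univ _, ?_⟩
  rw [map_add]
  exact abs_add_lt_of_mul_neg hk

lemma absSum_pos {h : κ → F →ₗ[ℝ] ℝ} (hh : ∀ x, (∀ k, h k x = 0) → x = 0) {x : F} (hx : x ≠ 0) :
    0 < absSum h x := by
  refine (absSum_nonneg h x).lt_of_ne fun h0 => hx (hh x fun k => ?_)
  have := (Finset.sum_eq_zero_iff_of_nonneg (fun k _ => abs_nonneg (h k x))).1 h0.symm k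
    (Finset.mem_univ k)
  exact abs_eq_zero.1 this

lemma convex_absSum_le : Convex ℝ {x | absSum h x ≤ 1} := by
  intro x hx y hy a b ha hb hab
  have h1 := absSum_add_le h (a • x) (b • y)
  rw [absSum_smul, absSum_smul, abs_of_nonneg ha, abs_of_nonneg hb] at h1
  have hx' : absSum h x ≤ 1 := hx
  have hy' : absSum h y ≤ 1 := hy
  change absSum h (a • x + b • y) ≤ 1
  nlinarith

/-- A value below `1` leaves room to move by `± t • x` within the ball. -/
lemma absSum_eq_one_of_mem_extremePoints [Nontrivial F] {h : κ → F →ₗ[ℝ] ℝ} (hh : ∀ x, (∀ k, h k x = 0) → x = 0)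
    {a : F} (ha : a ∈ extremePoints ℝ {x | absSum h x ≤ 1}) : absSum h a = 1 := by
  rw [mem_extremePoints] at ha
  obtain ⟨ha1, ha2⟩ := ha
  refine le_antisymm ha1 (not_lt.1 fun hlt => ?_)
  obtain ⟨x, hx⟩ := exists_ne (0 : F)
  have hxpos := absSum_pos hh hx
  set t := (1 - absSum h a) / absSum h x with ht
  have htpos : 0 < t := div_pos (by linarith) hxpos
  have hNt : absSum h (t • x) = 1 - absSum h a := by
    rw [absSum_smul, abs_of_pos htpos, ht]; field_simp
  have h1 : absSum h (a + t • x) ≤ 1 := (absSum_add_le h _ _).trans (by linarith)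
  have h2 : absSum h (a - t • x) ≤ 1 := by
    rw [sub_eq_add_neg]
    exact (absSum_add_le h _ _).trans (by rw [absSum_neg]; linarith)
  have := (ha2 _ h1 _ h2 ⟨1 / 2, 1 / 2, by norm_num, by norm_num, by norm_num, by module⟩).1
  have : t • x = 0 := by simpa using this
  exact (smul_ne_zero htpos.ne' hx) this

/-- The signs of the forms determine an extreme point: if `a` and `b` have equal signs, `absSum` is
linear along `a + ε • (a - b)` for small `ε`, so this point is in the ball and `a` is inside the
segment from it to `b`. -/
lemma finite_extremePoints_absSum_le {h : κ → F →ₗ[ℝ] ℝ} (hh : ∀ x, (∀ k, h k x = 0) → x = 0) :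
    (extremePoints ℝ {x | absSum h x ≤ 1}).Finite := by
  rcases subsingleton_or_nontrivial F with hF | hF
  · exact Set.toFinite _
  refine Set.Finite.of_injOn (f := fun a k => SignType.sign (h k a)) (mapsTo_univ _ _) ?_
    Set.finite_univ
  intro a ha b hb hab
  have hNa := absSum_eq_one_of_mem_extremePoints hh ha
  have hNb := absSum_eq_one_of_mem_extremePoints hh hb
  have hsign : ∀ k, SignType.sign (h k a) = SignType.sign (h k b) := fun k => congrFun hab k
  let s : κ → ℝ := fun k => (SignType.sign (h k a) : ℝ)
  have hev : ∀ᶠ ε : ℝ in 𝓝 0, ∀ k, |h k a + ε * (h k a - h k b)| =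
      s k * (h k a + ε * (h k a - h k b)) := by
    refine eventually_all.2 fun k => ?_
    have hcont : ContinuousAt (fun ε : ℝ => h k a + ε * (h k a - h k b)) 0 := by fun_prop
    rcases lt_trichotomy (h k a) 0 with h1 | h1 | h1
    · filter_upwards [hcont.eventually_lt (continuousAt_const (y := (0 : ℝ))) (by simpa using h1)]
        with ε hε
      rw [abs_of_neg hε]
      simp [s, sign_neg h1]
    · have h2 : h k b = 0 := by
        have := hsign k
        rw [h1, sign_zero] at this
        exact sign_eq_zero_iff.1 this.symm
      simp [h1, h2]
    · filter_upwards [(continuousAt_const (y := (0 : ℝ))).eventually_lt hcont (by simpa using h1)]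
        with ε hε
      rw [abs_of_pos hε]
      simp [s, sign_pos h1]
  obtain ⟨ε, hε, hεpos⟩ := ((hev.filter_mono nhdsWithin_le_nhds).and
    (self_mem_nhdsWithin (s := Ioi (0 : ℝ)))).exists
  have hεpos : 0 < ε := hεpos
  have hmem : absSum h (a + ε • (a - b)) ≤ 1 := by
    have h1 : absSum h (a + ε • (a - b)) = ∑ k, s k * (h k a + ε * (h k a - h k b)) := by
      refine Finset.sum_congr rfl fun k _ => ?_
      rw [← hε k]
      simp
    have h2 : ∑ k, s k * (h k a) = 1 := by
      rw [← hNa]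
      exact Finset.sum_congr rfl fun k _ => sign_mul_self _
    have h3 : ∑ k, s k * (h k b) = 1 := by
      rw [← hNb]
      refine Finset.sum_congr rfl fun k _ => ?_
      simp only [s]
      rw [hsign k]
      exact sign_mul_self _
    have h4 : ∑ k, s k * (h k a + ε * (h k a - h k b)) =
        ∑ k, s k * (h k a) + ε * (∑ k, s k * (h k a) - ∑ k, s k * (h k b)) := by
      rw [← Finset.sum_sub_distrib, Finset.mul_sum, ← Finset.sum_add_distrib]
      exact Finset.sum_congr rfl fun k _ => by ring
    rw [h1, h4, h2, h3]
    simp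
  rw [mem_extremePoints] at ha
  refine ((ha.2 _ hmem b hNb.le ⟨1 / (1 + ε), ε / (1 + ε), by positivity, by positivity,
    by field_simp, ?_⟩).2).symm
  have : (1 + ε) ≠ 0 := by positivity
  rw [smul_add, smul_smul, smul_sub]
  have e1 : (1 / (1 + ε)) • a + ((1 / (1 + ε) * ε) • a - (1 / (1 + ε) * ε) • b) + (ε / (1 + ε)) • b
      = ((1 + ε) / (1 + ε)) • a := by
    have : ε / (1 + ε) = 1 / (1 + ε) * ε := by ring
    rw [this, add_div, add_smul]
    have : ε / (1 + ε) = 1 / (1 + ε) * ε := by ring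
    rw [this]
    abel
  rw [e1, div_self this, one_smul]

variable [FiniteDimensional ℝ F]

lemma continuous_absSum : Continuous (absSum h) :=
  continuous_finsetSum _ fun k _ => (LinearMap.continuous_of_finiteDimensional (h k)).abs

variable {h}

lemma isCompact_absSum_le (hh : ∀ x, (∀ k, h k x = 0) → x = 0) :
    IsCompact {x | absSum h x ≤ 1} := by
  have hker : (LinearMap.pi h).ker = ⊥ := by
    rw [LinearMap.ker_eq_bot']
    intro x hx
    exact hh x fun k => congrFun hx k
  have hemb := LinearMap.isClosedEmbedding_of_injective hker
  refine (hemb.isCompact_preimage (isCompact_closedBall (0 : κ → ℝ) 1)).of_isClosed_subset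
    (isClosed_le (continuous_absSum h) continuous_const) ?_
  intro x hx
  simp only [mem_preimage, Metric.mem_closedBall, dist_zero_right]
  refine (pi_norm_le_iff_of_nonneg zero_le_one).2 fun k => ?_
  calc ‖h k x‖ ≤ ∑ k, |h k x| :=
        Finset.single_le_sum (f := fun k => |h k x|) (fun k _ => abs_nonneg _) (Finset.mem_univ k)
    _ ≤ 1 := hx

/-- Krein–Milman; finiteness makes the closure superfluous. -/
lemma convexHull_extremePoints_absSum_le (hh : ∀ x, (∀ k, h k x = 0) → x = 0) :
    convexHull ℝ (extremePoints ℝ {x | absSum h x ≤ 1}) = {x | absSum h x ≤ 1} := by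
  rw [← ((finite_extremePoints_absSum_le hh).isClosed_convexHull ℝ).closure_eq]
  exact closure_convexHull_extremePoints (isCompact_absSum_le hh) (convex_absSum_le h)

end AbsSum

/-! ### Generic symmetric heights. -/

section Generic

open Filter Topology

variable {F : Type*} [AddCommGroup F] [Module ℝ F] {ι : Type*} [Fintype ι]

/-- Generic symmetric heights close to `1`: the points at which a linear form takes the prescribed
heights are linearly independent. -/
lemma exists_generic_heights (a : ι → F) (neg : ι → ι) (hneg : ∀ i, neg (neg i) = i)
    (ha : ∀ i, a (neg i) = -a i) {p : (ι → ℝ) → Prop} (hp : ∀ᶠ μ in 𝓝 (1 : ι → ℝ), p μ) :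
    ∃ μ : ι → ℝ, p μ ∧ (∀ i, 0 < μ i) ∧ (∀ i, μ (neg i) = μ i) ∧
      ∀ (f : F →ₗ[ℝ] ℝ) (c : ι → ℝ), (∀ i, c i ≠ 0 → f (a i) = μ i) →
        ∑ i, c i • a i = 0 → c = 0 := by
  classical
  -- One dependency is fixed for each antipode-free index set that carries one, so finitely many
  -- conditions on the heights suffice.
  let bad : Finset ι → Prop := fun I => ∃ c : ι → ℝ, c ≠ 0 ∧ (∀ i, i ∉ I → c i = 0) ∧
    ∑ i, c i • a i = 0
  let T := {I : Finset ι // bad I ∧ ∀ i ∈ I, neg i ∉ I}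
  choose c hc0 hcI hcs using fun I : T => I.2.1
  -- The derivative of `∑ i, c I i * μ i` in the symmetrized direction `ν`. It is not the zero form:
  -- as `I` contains no antipodal pair, nothing cancels.
  let φ : T → Module.Dual ℝ (ι → ℝ) := fun I =>
    ∑ i, c I i • ((LinearMap.proj i : (ι → ℝ) →ₗ[ℝ] ℝ) + LinearMap.proj (neg i))
  have hφ : ∀ I ν, φ I ν = ∑ i, c I i * (ν i + ν (neg i)) := by
    intro I ν
    simp [φ, LinearMap.sum_apply, mul_add]
  obtain ⟨ν, hν⟩ := Module.Dual.exists_forall_ne_zero_of_forall_exists φ (by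
    intro I
    obtain ⟨i0, hi0⟩ := Function.ne_iff.1 (hc0 I)
    have hi0I : i0 ∈ I.1 := by
      by_contra hcon
      exact hi0 (hcI I i0 hcon)
    refine ⟨Pi.single i0 1, ?_⟩
    rw [hφ, Finset.sum_eq_single i0]
    · have : neg i0 ≠ i0 := fun h => I.2.2 i0 hi0I (by rw [h]; exact hi0I)
      simpa [Pi.single_apply, this] using hi0
    · intro i _ hi
      by_cases h1 : neg i = i0
      · have : i ∉ I.1 := by
          have := I.2.2 i0 hi0I
          rwa [← h1, hneg] at this
        rw [hcI I i this, zero_mul]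
      · simp [hi, h1]
    · simp)
  let μ : ℝ → ι → ℝ := fun ε i => 1 + ε * (ν i + ν (neg i))
  have hμ : Tendsto μ (𝓝 0) (𝓝 1) := by
    have : Continuous μ := by fun_prop
    have h0 : μ 0 = 1 := by funext i; simp [μ]
    rw [← h0]
    exact this.tendsto 0
  have hgen : ∀ᶠ ε in 𝓝[>] (0 : ℝ), ∀ I : T, ∑ i, c I i * μ ε i ≠ 0 := by
    refine eventually_all.2 fun I => ?_
    have hsum : ∀ ε, ∑ i, c I i * μ ε i = ∑ i, c I i + ε * φ I ν := by
      intro ε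
      rw [hφ, Finset.mul_sum, ← Finset.sum_add_distrib]
      exact Finset.sum_congr rfl fun i _ => by simp only [μ]; ring
    simp_rw [hsum]
    by_cases h0 : ∑ i, c I i = 0
    · filter_upwards [self_mem_nhdsWithin] with ε hε
      rw [h0, zero_add]
      exact mul_ne_zero (ne_of_gt hε) (hν I)
    · have hcont : ContinuousAt (fun ε : ℝ => ∑ i, c I i + ε * φ I ν) 0 := by fun_prop
      exact (hcont.eventually_ne (by simpa using h0)).filter_mono nhdsWithin_le_nhds
  have hpos : ∀ᶠ μ in 𝓝 (1 : ι → ℝ), ∀ i, 0 < μ i := by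
    refine eventually_all.2 fun i => ?_
    exact (continuous_apply i).continuousAt.eventually (lt_mem_nhds (by simp))
  obtain ⟨ε, hε1, hε2, hε3⟩ := (hgen.and ((hμ.eventually (hp.and hpos)).filter_mono
    nhdsWithin_le_nhds)).exists
  refine ⟨μ ε, hε2, hε3, fun i => by simp only [μ, hneg]; ring, ?_⟩
  intro f d hd hds
  by_contra hd0
  -- A linear form is not positive at both `a i` and its negative, so the support of `d` is one of
  -- the finitely many sets in `T`.
  have hfree : ∀ i, d i ≠ 0 → d (neg i) = 0 := by
    intro i hi
    by_contra hni
    have h1 := hd i hi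
    have h2 := hd _ hni
    rw [ha, map_neg, h1] at h2
    linarith [hε3 i, hε3 (neg i)]
  let I : T := ⟨Finset.univ.filter fun i => d i ≠ 0, ⟨d, hd0, by simp, hds⟩, by
    intro i hi
    simpa using hfree i (by simpa using hi)⟩
  apply hε1 I
  -- Since `f` takes the heights `μ` on `I`, this equation says that `c I` annihilates the heights,
  -- which genericity excludes.
  have h1 : f (∑ i, c I i • a i) = 0 := by rw [hcs I, map_zero]
  rw [map_sum] at h1
  rw [← h1]
  refine Finset.sum_congr rfl fun i _ => ?_
  rw [map_smul, smul_eq_mul]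
  by_cases hi : d i = 0
  · have : c I i = 0 := hcI I i (by simp [I, hi])
    rw [this, zero_mul, zero_mul]
  · rw [hd i hi]

end Generic

/-! ### The simplicial perturbation of the ball. -/

section Points

open Filter Topology

universe u

variable {F : Type u} [NormedAddCommGroup F] [NormedSpace ℝ F]

/-- A point in the boundary of a compact convex neighbourhood of the origin on each ray, with a
supporting linear form. -/
lemma exists_supporting {P : Set F} (hP : Convex ℝ P) (hc : IsCompact P) (h0 : P ∈ 𝓝 (0 : F))
    {x : F} (hx : x ≠ 0) : ∃ (f : F →ₗ[ℝ] ℝ) (r : ℝ), 0 < r ∧ (∀ y ∈ P, f y ≤ 1) ∧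
      f (r • x) = 1 ∧ r • x ∈ P := by
  have habs : Absorbent ℝ P := absorbent_nhds_zero h0
  have hg : 0 < gauge P x :=
    (gauge_pos habs (NormedSpace.isVonNBounded_of_isBounded _ hc.isBounded)).2 hx
  -- Hahn–Banach, extending `t • x ↦ t * gauge P x` under domination by the gauge.
  obtain ⟨f, hf1, hf2⟩ := exists_extension_of_le_sublinear
    (LinearPMap.mkSpanSingleton (K := ℝ) x (gauge P x) hx) (gauge P)
    (fun c hc x => gauge_smul_of_nonneg hc.le x) (gauge_add_le hP habs) (by
      rintro ⟨y, hy⟩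
      obtain ⟨t, rfl⟩ := Submodule.mem_span_singleton.1 hy
      rw [show (LinearPMap.mkSpanSingleton (K := ℝ) x (gauge P x) hx) ⟨t • x, hy⟩ =
        t • gauge P x from LinearPMap.mkSpanSingleton'_apply _ _ _ _ _]
      rcases le_or_gt 0 t with ht | ht
      · exact (gauge_smul_of_nonneg ht x).ge
      · exact le_trans (by rw [smul_eq_mul]; nlinarith) (gauge_nonneg (t • x)))
  have hfx : f x = gauge P x := by
    exact (hf1 ⟨x, Submodule.mem_span_singleton_self x⟩).trans
      (LinearPMap.mkSpanSingleton'_apply_self _ _ _ _)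
  refine ⟨f, (gauge P x)⁻¹, inv_pos.2 hg, fun y hy => (hf2 y).trans (gauge_le_one_of_mem hy), ?_, ?_⟩
  · rw [map_smul, hfx, smul_eq_mul, inv_mul_cancel₀ hg.ne']
  · refine hc.isClosed.closure_subset ?_
    rw [← gauge_le_one_iff_mem_closure hP h0,
      gauge_smul_of_nonneg (inv_pos.2 hg).le, smul_eq_mul, inv_mul_cancel₀ hg.ne']

variable [FiniteDimensional ℝ F]

/-- The vertices of a simplicial centrally symmetric polytope on whose proper faces the linear
forms of a given finite spanning family have constant signs. -/
theorem exists_simplicial_points {κ : Type*} [Finite κ] (h : κ → F →ₗ[ℝ] ℝ)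
    (hh : ∀ x, (∀ k, h k x = 0) → x = 0) :
    ∃ (ι : Type u) (_ : Fintype ι) (p : ι → F),
      (∀ i, ∃ j, p j = -p i) ∧
      (∀ f : F →ₗ[ℝ] ℝ, (∀ i, f (p i) ≤ 1) → ∀ c : ι → ℝ, (∀ i, f (p i) ≠ 1 → c i = 0) →
        ∑ i, c i • p i = 0 → c = 0) ∧
      (∀ f : F →ₗ[ℝ] ℝ, (∀ i, f (p i) ≤ 1) → ∀ k i j, f (p i) = 1 → f (p j) = 1 →
        0 ≤ h k (p i) * h k (p j)) ∧
      convexHull ℝ (range p) ∈ 𝓝 (0 : F) := by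
  classical
  have := Fintype.ofFinite κ
  rcases subsingleton_or_nontrivial F with hF | hF
  · refine ⟨PUnit, inferInstance, fun _ => 0, fun i => ⟨i, by simp⟩, ?_, by simp, ?_⟩
    · intro f _ c hc _
      funext i
      exact hc i (by simp)
    · have : convexHull ℝ (range fun _ : PUnit => (0 : F)) = univ :=
        Subsingleton.eq_univ_of_nonempty ((range_nonempty _).convexHull)
      rw [this]
      exact univ_mem
  set A : Set F := extremePoints ℝ {x | absSum h x ≤ 1} with hA
  have hfin : A.Finite := finite_extremePoints_absSum_le hh
  have hull : convexHull ℝ A = {x | absSum h x ≤ 1} := convexHull_extremePoints_absSum_le hh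
  have hone : ∀ a ∈ A, absSum h a = 1 := fun a ha => absSum_eq_one_of_mem_extremePoints hh ha
  have hnegA : ∀ a ∈ A, -a ∈ A := by
    intro a ha
    rw [hA, mem_extremePoints] at ha ⊢
    refine ⟨show absSum h (-a) ≤ 1 by rw [absSum_neg]; exact ha.1, fun x hx y hy hxy => ?_⟩
    have hx' : absSum h (-x) ≤ 1 := by rw [absSum_neg]; exact hx
    have hy' : absSum h (-y) ≤ 1 := by rw [absSum_neg]; exact hy
    obtain ⟨s, t, hs, ht, hst, he⟩ := hxy
    have := ha.2 (-x) hx' (-y) hy' ⟨s, t, hs, ht, hst, by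
      rw [smul_neg, smul_neg, ← neg_add, he, neg_neg]⟩
    exact ⟨neg_eq_iff_eq_neg.1 this.1, neg_eq_iff_eq_neg.1 this.2⟩
  have hneA : A.Nonempty := (isCompact_absSum_le hh).extremePoints_nonempty ⟨0, by simp [absSum]⟩
  have : Fintype A := hfin.fintype
  let neg : A → A := fun a => ⟨-a, hnegA a a.2⟩
  -- At `μ = 1` the conclusion is the hypothesis, so it persists nearby.
  have hev : ∀ᶠ μ in 𝓝 (1 : A → ℝ), ∀ i j l : A, absSum h ((i : F) + j) < 2 →
      absSum h ((i : F) + j) * μ l < μ i + μ j := by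
    refine eventually_all.2 fun i => eventually_all.2 fun j => eventually_all.2 fun l => ?_
    by_cases hlt : absSum h ((i : F) + j) < 2
    · have h1 : ContinuousAt (fun μ : A → ℝ => absSum h ((i : F) + j) * μ l) 1 :=
        continuousAt_const.mul (continuous_apply l).continuousAt
      have h2 : ContinuousAt (fun μ : A → ℝ => μ i + μ j) 1 := by fun_prop
      filter_upwards [h1.eventually_lt h2 (by simp; linarith)] with μ hμ _ using hμ
    · exact Eventually.of_forall fun μ h => absurd h hlt
  obtain ⟨μ, hμ1, hμ2, hμ3, hμ4⟩ := exists_generic_heights (fun a : A => (a : F)) neg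
    (fun i => Subtype.ext (neg_neg _)) (fun i => rfl) hev
  let p : A → F := fun a => (μ a)⁻¹ • (a : F)
  have hf : ∀ (f : F →ₗ[ℝ] ℝ) i, f (p i) = (μ i)⁻¹ * f i := fun f i => by simp [p]
  have hfle : ∀ (f : F →ₗ[ℝ] ℝ) i, f (p i) ≤ 1 ↔ f i ≤ μ i := fun f i => by
    rw [hf, inv_mul_le_iff₀ (hμ2 i), mul_one]
  have hfeq : ∀ (f : F →ₗ[ℝ] ℝ) i, f (p i) = 1 ↔ f i = μ i := fun f i => by
    rw [hf, inv_mul_eq_iff_eq_mul₀ (hμ2 i).ne', mul_one]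
  have hsym : ∀ i, ∃ j, p j = -p i := fun i => ⟨neg i, by simp [p, hμ3, neg]⟩
  refine ⟨A, inferInstance, p, hsym, ?_, ?_, ?_⟩
  · intro f _ c hc hs
    have := hμ4 f (fun i => c i * (μ i)⁻¹) (by
      intro i hi
      rw [← hfeq]
      by_contra hcon
      exact hi (by simp [hc i hcon])) (by
      rw [← hs]
      exact Finset.sum_congr rfl fun i _ => by simp only [p, smul_smul])
    funext i
    have h1 := congrFun this i
    simpa [(hμ2 i).ne'] using h1
  · intro f hle k i j hi hj
    by_contra! hneg
    rw [hfeq] at hi hj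
    have hneg' : h k (i : F) * h k (j : F) < 0 := by
      rw [hf, hf] at hneg
      have h1 := inv_pos.2 (hμ2 i)
      have h2 := inv_pos.2 (hμ2 j)
      by_contra! h3
      have : 0 ≤ ((μ i)⁻¹ * (μ j)⁻¹) * (h k (i : F) * h k (j : F)) := by positivity
      nlinarith
    have hlt : absSum h ((i : F) + j) < 2 := by
      have := absSum_add_lt h hneg'
      rw [hone i i.2, hone j j.2] at this
      linarith
    have hfs : f ((i : F) + j) = μ i + μ j := by rw [map_add, hi, hj]
    have hne : (i : F) + j ≠ 0 := by
      intro h0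
      rw [h0, map_zero] at hfs
      linarith [hμ2 i, hμ2 j]
    have hN := absSum_pos hh hne
    -- The normalized sum is in the old ball, so `f` is at least as large at some old vertex `l`. By
    -- the choice of heights that value exceeds `μ l`, violating `f (p l) ≤ 1`.
    have hb : (absSum h ((i : F) + j))⁻¹ • ((i : F) + j) ∈ convexHull ℝ A := by
      rw [hull]
      change absSum h _ ≤ 1
      rw [absSum_smul, abs_of_pos (inv_pos.2 hN), inv_mul_cancel₀ hN.ne']
    obtain ⟨l, hl, hfl⟩ := (f.convexOn convex_univ).exists_ge_of_mem_convexHull (subset_univ _) hb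
    have h1 := (hfle f ⟨l, hl⟩).1 (hle _)
    rw [map_smul, smul_eq_mul, inv_mul_le_iff₀ hN, hfs] at hfl
    have h2 := hμ1 i j ⟨l, hl⟩ hlt
    have h3 : absSum h ((i : F) + j) * f l ≤ absSum h ((i : F) + j) * μ ⟨l, hl⟩ :=
      mul_le_mul_of_nonneg_left h1 hN.le
    linarith
  · have hconv : Convex ℝ (convexHull ℝ (range p)) := convex_convexHull ℝ _
    have hpm : ∀ i, p i ∈ convexHull ℝ (range p) := fun i => subset_convexHull ℝ _ ⟨i, rfl⟩
    obtain ⟨a0, ha0⟩ := hneA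
    have h0 : (0 : F) ∈ convexHull ℝ (range p) := by
      obtain ⟨j, hj⟩ := hsym ⟨a0, ha0⟩
      have := hconv (hpm ⟨a0, ha0⟩) (hpm j) (a := 1 / 2) (b := 1 / 2) (by norm_num) (by norm_num)
        (by norm_num)
      rw [hj] at this
      simpa using this
    -- Any upper bound for the heights would do: the new polytope contains `M⁻¹` times the old ball.
    set M := ∑ i, μ i with hM
    have hle : ∀ i, μ i ≤ M := fun i =>
      Finset.single_le_sum (fun j _ => (hμ2 j).le) (Finset.mem_univ i)
    have hMpos : 0 < M := (hμ2 ⟨a0, ha0⟩).trans_le (hle _)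
    have hsub : ∀ y ∈ convexHull ℝ A, M⁻¹ • y ∈ convexHull ℝ (range p) := by
      have hpre : Convex ℝ ((LinearMap.lsmul ℝ F M⁻¹) ⁻¹' convexHull ℝ (range p)) :=
        hconv.linear_preimage _
      refine convexHull_min (fun a ha => ?_) hpre
      have := hconv.smul_mem_of_zero_mem h0 (hpm ⟨a, ha⟩) (t := M⁻¹ * μ ⟨a, ha⟩)
        ⟨by have := hμ2 ⟨a, ha⟩; positivity, by
          rw [inv_mul_le_iff₀ hMpos, mul_one]; exact hle _⟩
      rw [smul_smul, mul_assoc, mul_inv_cancel₀ (hμ2 _).ne', mul_one] at this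
      exact this
    refine Filter.mem_of_superset ((isOpen_lt (continuous_absSum h)
      (continuous_const (y := M⁻¹))).mem_nhds (by simpa [absSum] using hMpos)) ?_
    intro x hx
    have hx' : absSum h x < M⁻¹ := hx
    have := hsub (M • x) (by
      rw [hull]
      change absSum h _ ≤ 1
      rw [absSum_smul, abs_of_pos hMpos]
      have := mul_lt_mul_of_pos_left hx' hMpos
      rw [mul_inv_cancel₀ hMpos.ne'] at this
      exact this.le)
    rwa [smul_smul, inv_mul_cancel₀ hMpos.ne', one_smul] at this

end Points

/-! ### Faces of symmetric simplicial polytopes. -/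

section Faces

variable {E : Type*} [NormedAddCommGroup E] [NormedSpace ℝ E] {ι : Type*} [Fintype ι] {p : ι → E}

lemma mem_convexHull_range_iff {x : E} : x ∈ convexHull ℝ (range p) ↔
    ∃ w : ι → ℝ, (∀ i, 0 ≤ w i) ∧ ∑ i, w i = 1 ∧ ∑ i, w i • p i = x := by
  constructor
  · intro hx
    let Q : Set E := {x | ∃ w : ι → ℝ, (∀ i, 0 ≤ w i) ∧ ∑ i, w i = 1 ∧ ∑ i, w i • p i = x}
    have hQ : Convex ℝ Q := by
      rintro _ ⟨w, hw, hw1, rfl⟩ _ ⟨v, hv, hv1, rfl⟩ a b ha hb hab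
      refine ⟨fun i => a * w i + b * v i, fun i => ?_, ?_, ?_⟩
      · have := hw i; have := hv i; positivity
      · rw [Finset.sum_add_distrib, ← Finset.mul_sum, ← Finset.mul_sum, hw1, hv1]; linarith
      · simp only [add_smul, mul_smul, Finset.sum_add_distrib, Finset.smul_sum]
    classical
    refine convexHull_min (t := Q) ?_ hQ hx
    rintro _ ⟨i, rfl⟩
    refine ⟨Pi.single i 1, fun j => ?_, by simp, ?_⟩
    · by_cases h : j = i
      · subst h; simp
      · simp [h]
    · rw [Finset.sum_eq_single i]
      · simp
      · intro j _ hj; simp [hj]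
      · simp
  · rintro ⟨w, hw, hw1, hx⟩
    exact mem_convexHull_of_exists_fintype w p hw hw1 (fun i => ⟨i, rfl⟩) hx

/-- Membership in the convex hull of a subfamily, by weights vanishing off the subfamily. -/
lemma mem_convexHull_image_of_weights {J : Set ι} {w : ι → ℝ} (hw : ∀ i, 0 ≤ w i)
    (hw1 : ∑ i, w i = 1) (hJ : ∀ i, i ∉ J → w i = 0) :
    ∑ i, w i • p i ∈ convexHull ℝ (p '' J) := by
  classical
  have h1 : ∑ i ∈ Finset.univ.filter (· ∈ J), w i = 1 := by
    rw [← hw1]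
    exact Finset.sum_filter_of_ne fun i _ hi => by by_contra h; exact hi (hJ i h)
  have h2 : ∑ i ∈ Finset.univ.filter (· ∈ J), w i • p i = ∑ i, w i • p i :=
    Finset.sum_filter_of_ne fun i _ hi => by by_contra h; exact hi (by rw [hJ i h, zero_smul])
  rw [← h2]
  exact (convex_convexHull ℝ _).sum_mem (fun i _ => hw i) h1 fun i hi =>
    subset_convexHull ℝ _ ⟨i, by simpa using hi, rfl⟩

lemma le_one_of_mem_convexHull {ι : Type*} {p : ι → E} {f : E →ₗ[ℝ] ℝ} (hf : ∀ i, f (p i) ≤ 1) {x : E}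
    (hx : x ∈ convexHull ℝ (range p)) : f x ≤ 1 := by
  obtain ⟨_, ⟨i, rfl⟩, hi⟩ :=
    (f.convexOn convex_univ).exists_ge_of_mem_convexHull (subset_univ _) hx
  exact hi.trans (hf i)

lemma weight_eq_zero_of_apply_eq_one {f : E →ₗ[ℝ] ℝ} (hf : ∀ i, f (p i) ≤ 1) {w : ι → ℝ}
    (hw : ∀ i, 0 ≤ w i) (hw1 : ∑ i, w i = 1) (hx : f (∑ i, w i • p i) = 1) {i : ι}
    (hi : f (p i) ≠ 1) : w i = 0 := by
  have h1 : ∑ i, w i * (1 - f (p i)) = 0 := by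
    simp only [mul_sub, mul_one, Finset.sum_sub_distrib, hw1]
    rw [map_sum] at hx
    simp only [map_smul, smul_eq_mul] at hx
    rw [hx, sub_self]
  have h2 := (Finset.sum_eq_zero_iff_of_nonneg
    (fun i _ => mul_nonneg (hw i) (sub_nonneg.2 (hf i)))).1 h1 i (Finset.mem_univ i)
  exact (mul_eq_zero.1 h2).resolve_right fun h => hi (by linarith)

/-- The part of the polytope on a supporting hyperplane is spanned by the contact points. -/
lemma sep_apply_eq_one {f : E →ₗ[ℝ] ℝ} (hf : ∀ i, f (p i) ≤ 1) :
    {x ∈ convexHull ℝ (range p) | f x = 1} = convexHull ℝ (p '' {i | f (p i) = 1}) := by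
  apply Subset.antisymm
  · rintro x ⟨hx, hfx⟩
    obtain ⟨w, hw, hw1, rfl⟩ := mem_convexHull_range_iff.1 hx
    exact mem_convexHull_image_of_weights hw hw1 fun i hi =>
      weight_eq_zero_of_apply_eq_one hf hw hw1 hfx hi
  · refine convexHull_min ?_ ((convex_convexHull ℝ _).inter (convex_hyperplane f.isLinear 1))
    rintro _ ⟨i, hi, rfl⟩
    exact ⟨subset_convexHull ℝ _ ⟨i, rfl⟩, hi⟩

/-- A finite centrally symmetric family of points such that the points on each supporting
hyperplane of its convex hull `P` are linearly independent, so that `P` is simplicial. -/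
structure IsSimplicialFamily (p : ι → E) : Prop where
  symm : ∀ i, ∃ j, p j = -p i
  indep : ∀ f : E →ₗ[ℝ] ℝ, (∀ i, f (p i) ≤ 1) → ∀ c : ι → ℝ, (∀ i, f (p i) ≠ 1 → c i = 0) →
    ∑ i, c i • p i = 0 → c = 0

lemma zero_mem_of_symm {ι : Type*} {p : ι → E} (hsym : ∀ i, ∃ j, p j = -p i) (i : ι) :
    (0 : E) ∈ convexHull ℝ (range p) := by
  obtain ⟨j, hj⟩ := hsym i
  have := convex_convexHull ℝ (range p) (subset_convexHull ℝ _ ⟨i, rfl⟩)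
    (subset_convexHull ℝ _ ⟨j, rfl⟩) (a := 1 / 2) (b := 1 / 2) (by norm_num) (by norm_num)
    (by norm_num)
  rw [hj] at this
  simpa using this

lemma neg_mem_of_symm (hsym : ∀ i, ∃ j, p j = -p i) {x : E} (hx : x ∈ convexHull ℝ (range p)) :
    -x ∈ convexHull ℝ (range p) := by
  obtain ⟨w, hw, hw1, rfl⟩ := mem_convexHull_range_iff.1 hx
  rw [← Finset.sum_neg_distrib]
  simp only [← smul_neg]
  refine (convex_convexHull ℝ _).sum_mem (fun i _ => hw i) hw1 fun i _ => ?_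
  obtain ⟨j, hj⟩ := hsym i
  exact hj ▸ subset_convexHull ℝ _ ⟨j, rfl⟩

namespace IsSimplicialFamily

/-- A proper face is spanned by the contact points of a supporting hyperplane. -/
lemma exists_of_isProperFace (hp : IsSimplicialFamily p) {F : Set E}
    (hF : IsProperFace (convexHull ℝ (range p)) F) :
    ∃ f : E →ₗ[ℝ] ℝ, (∀ i, f (p i) ≤ 1) ∧ F = convexHull ℝ (p '' {i | f (p i) = 1}) ∧
      ∀ x ∈ F, f x = 1 := by
  obtain ⟨⟨hexp, hne⟩, hprop⟩ := hF
  obtain ⟨l, hl⟩ := hexp hne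
  obtain ⟨x0, hx0⟩ := hne
  have hx0' : x0 ∈ convexHull ℝ (range p) ∧ ∀ y ∈ convexHull ℝ (range p), l y ≤ l x0 := by
    rw [hl] at hx0; exact hx0
  -- Otherwise symmetry forces `l` to vanish on the polytope and the face is not proper. Positivity
  -- allows the maximum to be scaled to `1`.
  have hm : 0 < l x0 := by
    by_contra! hm
    have hle : ∀ y ∈ convexHull ℝ (range p), l y ≤ 0 := fun y hy => (hx0'.2 y hy).trans hm
    have hzero : ∀ y ∈ convexHull ℝ (range p), l y = 0 := fun y hy => by
      have h1 := hle y hy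
      have h2 := hle _ (neg_mem_of_symm hp.symm hy)
      rw [map_neg] at h2
      linarith
    apply hprop
    rw [hl]
    ext y
    exact ⟨fun h => h.1, fun h => ⟨h, fun z hz => by rw [hzero z hz, hzero y h]⟩⟩
  let f : E →ₗ[ℝ] ℝ := (l x0)⁻¹ • (l : E →ₗ[ℝ] ℝ)
  have hfv : ∀ x, f x = (l x0)⁻¹ * l x := fun x => by simp [f]
  have hf : ∀ i, f (p i) ≤ 1 := fun i => by
    rw [hfv, inv_mul_le_iff₀ hm, mul_one]
    exact hx0'.2 _ (subset_convexHull ℝ _ ⟨i, rfl⟩)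
  have hF : F = {x ∈ convexHull ℝ (range p) | f x = 1} := by
    rw [hl]
    ext x
    constructor
    · rintro ⟨hx, hmax⟩
      refine ⟨hx, ?_⟩
      rw [hfv, inv_mul_eq_iff_eq_mul₀ hm.ne', mul_one]
      exact le_antisymm (hx0'.2 x hx) (hmax _ hx0'.1)
    · rintro ⟨hx, hfx⟩
      rw [hfv, inv_mul_eq_iff_eq_mul₀ hm.ne', mul_one] at hfx
      exact ⟨hx, fun y hy => hfx ▸ hx0'.2 y hy⟩
  refine ⟨f, hf, hF.trans (sep_apply_eq_one hf), fun x hx => ?_⟩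
  rw [hF] at hx
  exact hx.2

lemma linearIndependent (hp : IsSimplicialFamily p) {f : E →ₗ[ℝ] ℝ} (hf : ∀ i, f (p i) ≤ 1) :
    LinearIndependent ℝ (fun i : {i // f (p i) = 1} => p i) := by
  classical
  rw [Fintype.linearIndependent_iff]
  intro g hg i
  have := hp.indep f hf (fun i => if h : f (p i) = 1 then g ⟨i, h⟩ else 0)
    (fun i hi => by simp [hi]) (by
      rw [← Finset.sum_filter_of_ne (p := fun i => f (p i) = 1) fun i _ hi => by
          by_contra h; simp [h] at hi,
        Finset.sum_subtype (p := fun i => f (p i) = 1) _ (by simp), ← hg]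
      exact Finset.sum_congr rfl fun i _ => by simp [i.2])
  have h2 := congrFun this i
  simpa [i.2] using h2

lemma isSimplex (hp : IsSimplicialFamily p) {F : Set E}
    (hF : IsProperFace (convexHull ℝ (range p)) F) : IsSimplex F := by
  classical
  obtain ⟨f, hf, hFf, -⟩ := hp.exists_of_isProperFace hF
  have hind := ((hp.linearIndependent hf).affineIndependent ℝ).range
  have hrange : range (fun i : {i // f (p i) = 1} => p i) =
      ((Finset.univ.filter fun i => f (p i) = 1).image p : Finset E) := by
    ext x; simp
  refine ⟨(Finset.univ.filter fun i => f (p i) = 1).image p, ?_, ?_⟩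
  · rw [hrange] at hind
    exact hind
  · rw [hFf]
    congr 1
    ext x; simp

/-- Linearly independent contact points can be given arbitrary values. -/
lemma exists_dual (hp : IsSimplicialFamily p) {f : E →ₗ[ℝ] ℝ} (hf : ∀ i, f (p i) ≤ 1) (g : ι → ℝ) :
    ∃ e : E →ₗ[ℝ] ℝ, ∀ i, f (p i) = 1 → e (p i) = g i := by
  have hv := hp.linearIndependent hf
  obtain ⟨e, he⟩ := LinearMap.exists_extend ((Module.Basis.span hv).constr ℝ fun i => g i)
  refine ⟨e, fun i hi => ?_⟩
  have h1 := LinearMap.congr_fun he (Module.Basis.span hv ⟨i, hi⟩)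
  rw [Module.Basis.constr_basis] at h1
  simpa [Module.Basis.span_apply] using h1

/-- Every set of contact points is the full set of contact points of some supporting hyperplane. -/
lemma exists_contact_eq (hp : IsSimplicialFamily p) {f : E →ₗ[ℝ] ℝ} (hf : ∀ i, f (p i) ≤ 1)
    {J : Set ι} (hJ : ∀ i ∈ J, f (p i) = 1) :
    ∃ f' : E →ₗ[ℝ] ℝ, (∀ i, f' (p i) ≤ 1) ∧ ∀ i, f' (p i) = 1 ↔ i ∈ J := by
  classical
  -- Tilting `f` by a small multiple of `e` keeps contact on `J`, breaks it at the other contact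
  -- points, and creates no new contact.
  obtain ⟨e, he⟩ := hp.exists_dual hf fun i => if i ∈ J then 0 else -1
  have hev : ∀ᶠ ε : ℝ in nhds 0, ∀ i, f (p i) ≠ 1 → f (p i) + ε * e (p i) < 1 := by
    refine Filter.eventually_all.2 fun i => ?_
    by_cases hi : f (p i) = 1
    · simp [hi]
    · have hcont : ContinuousAt (fun ε : ℝ => f (p i) + ε * e (p i)) 0 := by fun_prop
      filter_upwards [hcont.eventually_lt (continuousAt_const (y := (1 : ℝ)))
        (by simpa using lt_of_le_of_ne (hf i) hi)] with ε hε _ using hε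
  obtain ⟨ε, hε, hεpos⟩ := ((hev.filter_mono nhdsWithin_le_nhds).and
    (self_mem_nhdsWithin (s := Ioi (0 : ℝ)))).exists
  have hεpos : 0 < ε := hεpos
  have hval : ∀ i, (f + ε • e) (p i) = f (p i) + ε * e (p i) := fun i => by simp
  refine ⟨f + ε • e, fun i => ?_, fun i => ?_⟩ <;> rw [hval]
  · by_cases hi : f (p i) = 1
    · rw [he i hi, hi]
      split_ifs <;> linarith
    · exact (hε i hi).le
  · by_cases hi : f (p i) = 1
    · rw [he i hi, hi]
      split_ifs with h
      · simp [h]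
      · simp only [h, iff_false]; linarith
    · exact ⟨fun h => absurd h (hε i hi).ne, fun h => absurd (hJ i h) hi⟩

variable [FiniteDimensional ℝ E]

lemma isProperFace (hp : IsSimplicialFamily p) {f : E →ₗ[ℝ] ℝ} (hf : ∀ i, f (p i) ≤ 1) {i : ι}
    (hi : f (p i) = 1) :
    IsProperFace (convexHull ℝ (range p)) (convexHull ℝ (p '' {i | f (p i) = 1})) := by
  rw [← sep_apply_eq_one hf]
  have hmem : p i ∈ {x ∈ convexHull ℝ (range p) | f x = 1} := ⟨subset_convexHull ℝ _ ⟨i, rfl⟩, hi⟩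
  refine ⟨⟨fun _ => ⟨LinearMap.toContinuousLinearMap f, ?_⟩, _, hmem⟩, fun h => ?_⟩
  · ext x
    constructor
    · rintro ⟨hx, hfx⟩
      refine ⟨hx, fun y hy => ?_⟩
      simpa [hfx] using le_one_of_mem_convexHull hf hy
    · rintro ⟨hx, hmax⟩
      refine ⟨hx, le_antisymm (le_one_of_mem_convexHull hf hx) ?_⟩
      simpa [hi] using hmax _ hmem.1
  · have h0 := zero_mem_of_symm hp.symm i
    rw [← h] at h0
    simpa using h0.2

/-- Strictly positive combinations of the vertices of a face lie in its relative interior. -/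
lemma mem_intrinsicInterior (hp : IsSimplicialFamily p) {f : E →ₗ[ℝ] ℝ} (hf : ∀ i, f (p i) ≤ 1)
    {w : ι → ℝ} (hw1 : ∑ i, w i = 1) (hpos : ∀ i, f (p i) = 1 → 0 < w i)
    (hzero : ∀ i, f (p i) ≠ 1 → w i = 0) :
    ∑ i, w i • p i ∈ intrinsicInterior ℝ (convexHull ℝ (p '' {i | f (p i) = 1})) := by
  classical
  have hw : ∀ i, 0 ≤ w i := fun i => by
    by_cases hi : f (p i) = 1
    · exact (hpos i hi).le
    · exact (hzero i hi).ge
  -- Dual forms: on the affine span of the face they are barycentric coordinates, and their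
  -- positivity cuts out an open part of the face.
  choose e he using fun j : ι => hp.exists_dual hf (Pi.single j 1)
  let J : Finset ι := Finset.univ.filter fun i => f (p i) = 1
  have hJ : ∀ i, i ∈ J ↔ f (p i) = 1 := fun i => by simp [J]
  set F := convexHull ℝ (p '' {i | f (p i) = 1}) with hF
  have hx : ∑ i, w i • p i ∈ F := mem_convexHull_image_of_weights hw hw1 fun i hi => hzero i hi
  -- coordinates on the affine span
  have hcoord : ∀ z ∈ affineSpan ℝ F, z = ∑ j ∈ J, e j z • p j ∧ ∑ j ∈ J, e j z = 1 := by
    intro z hz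
    rw [hF, affineSpan_convexHull] at hz
    refine affineSpan_induction hz ?_ ?_
    · rintro _ ⟨i, hi, rfl⟩
      have hi' : i ∈ J := (hJ i).2 hi
      have hv : ∀ j, e j (p i) = (Pi.single j (1 : ℝ) : ι → ℝ) i := fun j => he j i hi
      constructor
      · rw [Finset.sum_eq_single i]
        · simp [hv]
        · intro j _ hj; simp [hv, hj.symm]
        · exact fun h => absurd hi' h
      · rw [Finset.sum_eq_single i]
        · simp [hv]
        · intro j _ hj; simp [hv, hj.symm]
        · exact fun h => absurd hi' h
    · rintro c u v z ⟨hu, hu1⟩ ⟨hv, hv1⟩ ⟨hz, hz1⟩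
      have hval : ∀ j, e j (c • (u -ᵥ v) +ᵥ z) = c * (e j u - e j v) + e j z := fun j => by simp
      constructor
      · simp only [hval, add_smul, mul_smul, sub_smul, Finset.sum_add_distrib, ← Finset.smul_sum,
          Finset.sum_sub_distrib, ← hu, ← hv, ← hz]
        rfl
      · simp only [hval, Finset.sum_add_distrib, ← Finset.mul_sum, Finset.sum_sub_distrib, hu1, hv1,
          hz1]
        ring
  have hev : ∀ j ∈ J, e j (∑ i, w i • p i) = w j := by
    intro j hj
    rw [map_sum, Finset.sum_eq_single j]
    · simp [he j j ((hJ j).1 hj)]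
    · intro i _ hij
      by_cases hi : f (p i) = 1
      · simp [he j i hi, hij]
      · simp [hzero i hi]
    · simp
  rw [_root_.mem_intrinsicInterior]
  refine ⟨⟨_, subset_affineSpan ℝ F hx⟩, ?_, rfl⟩
  refine mem_interior.2 ⟨{z | ∀ j ∈ J, 0 < e j (z : E)}, ?_, ?_, ?_⟩
  · intro z hz
    obtain ⟨h1, h2⟩ := hcoord z z.2
    change (z : E) ∈ F
    have h3 : ∑ i, (if i ∈ J then e i (z : E) else 0) • p i = z := by
      conv_rhs => rw [h1]
      simp only [ite_smul, zero_smul, Finset.sum_ite_mem, Finset.univ_inter]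
    rw [← h3]
    refine mem_convexHull_image_of_weights (fun i => ?_) ?_ fun i hi => ?_
    · split_ifs with h
      · exact (hz i h).le
      · exact le_rfl
    · simp only [Finset.sum_ite_mem, Finset.univ_inter, h2]
    · have : i ∉ J := fun h => hi ((hJ i).1 h)
      simp [this]
  · have : {z : affineSpan ℝ F | ∀ j ∈ J, 0 < e j (z : E)} =
        ⋂ j ∈ J, {z : affineSpan ℝ F | 0 < e j (z : E)} := by
      ext z; simp
    rw [this]
    exact isOpen_biInter_finset fun j _ => isOpen_lt continuous_const
      ((LinearMap.continuous_of_finiteDimensional (e j)).comp continuous_subtype_val)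
  · intro j hj
    rw [hev j hj]
    exact hpos j ((hJ j).1 hj)

/-- Every point of the boundary lies in the relative interior of a proper face. -/
lemma exists_isProperFace_mem (hp : IsSimplicialFamily p) {f : E →ₗ[ℝ] ℝ} (hf : ∀ i, f (p i) ≤ 1)
    {y : E} (hy : y ∈ convexHull ℝ (range p)) (hfy : f y = 1) :
    ∃ F, IsProperFace (convexHull ℝ (range p)) F ∧ y ∈ intrinsicInterior ℝ F := by
  obtain ⟨w, hw, hw1, rfl⟩ := mem_convexHull_range_iff.1 hy
  obtain ⟨f', hf', hJ⟩ := hp.exists_contact_eq hf (J := {i | w i ≠ 0}) fun i hi => by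
    by_contra h
    exact hi (weight_eq_zero_of_apply_eq_one hf hw hw1 hfy h)
  obtain ⟨i, hi⟩ : ∃ i, w i ≠ 0 := by
    by_contra! h
    simp [h] at hw1
  refine ⟨_, hp.isProperFace hf' ((hJ i).2 hi), hp.mem_intrinsicInterior hf' hw1 (fun j hj => ?_)
    fun j hj => ?_⟩
  · exact (hw j).lt_of_ne ((hJ j).1 hj).symm
  · by_contra h
    exact hj ((hJ j).2 h)

end IsSimplicialFamily

/-- A segment ending at a relative interior point of a set can be prolonged within the set. -/
lemma exists_prolongation {F : Set E} {x z : E} (hx : x ∈ intrinsicInterior ℝ F) (hz : z ∈ F) :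
    ∃ t : ℝ, 0 < t ∧ x + t • (x - z) ∈ F := by
  obtain ⟨y, hy, rfl⟩ := _root_.mem_intrinsicInterior.1 hx
  let γ : ℝ → affineSpan ℝ F := fun t => ⟨(y : E) + t • ((y : E) - z), by
    have := AffineMap.lineMap_mem (-t) y.2 (subset_affineSpan ℝ F hz)
    rw [AffineMap.lineMap_apply] at this
    convert this using 1
    simp only [vsub_eq_sub, vadd_eq_add]
    module⟩
  have hγ : Continuous γ := by
    refine Continuous.subtype_mk ?_ _
    fun_prop
  have h0 : γ 0 = y := Subtype.ext (by simp [γ])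
  have hev : ∀ᶠ t in nhds (0 : ℝ), γ t ∈ Subtype.val ⁻¹' F := by
    apply hγ.continuousAt.eventually
    rw [h0]
    exact mem_interior_iff_mem_nhds.1 hy
  obtain ⟨t, ht, htpos⟩ := ((hev.filter_mono nhdsWithin_le_nhds).and
    (self_mem_nhdsWithin (s := Ioi (0 : ℝ)))).exists
  exact ⟨t, htpos, ht⟩

/-- A linear form of constant weak sign on `F` has constant strict sign on its relative interior. -/
lemma sign_eq_of_mem_intrinsicInterior {F : Set E} {l : E →ₗ[ℝ] ℝ}
    (hl : ∀ x ∈ F, ∀ y ∈ F, 0 ≤ l x * l y) {x y : E} (hx : x ∈ intrinsicInterior ℝ F)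
    (hy : y ∈ intrinsicInterior ℝ F) (hpos : 0 < l x) : 0 < l y := by
  have hxF := intrinsicInterior_subset hx
  have hyF := intrinsicInterior_subset hy
  -- If `l y` were zero, prolonging the segment from `x` beyond `y` would make `l` negative.
  obtain ⟨t, ht, hmem⟩ := exists_prolongation hy hxF
  have h1 := hl _ hxF _ hyF
  have h2 := hl _ hxF _ hmem
  simp only [map_add, map_smul, map_sub, smul_eq_mul] at h2
  have h3 := nonneg_of_mul_nonneg_right h1 hpos
  have h4 := nonneg_of_mul_nonneg_right h2 hpos
  nlinarith [mul_pos ht hpos, mul_nonneg ht.le h3]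

/-- Pairwise sign compatibility at the contact points passes to the whole face. -/
lemma mul_nonneg_on_convexHull {l : E →ₗ[ℝ] ℝ} {S : Set E} (hS : ∀ x ∈ S, ∀ y ∈ S, 0 ≤ l x * l y) :
    ∀ x ∈ convexHull ℝ S, ∀ y ∈ convexHull ℝ S, 0 ≤ l x * l y := by
  have h1 : ∀ x ∈ S, ∀ y ∈ convexHull ℝ S, 0 ≤ l x * l y := by
    intro x hx y hy
    exact convexHull_min (t := {y | 0 ≤ (l x • l) y}) (fun y hy => hS x hx y hy)
      (convex_halfSpace_ge (l x • l).isLinear 0) hy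
  intro x hx y hy
  have := convexHull_min (t := {x | 0 ≤ (l y • l) x})
    (fun x hx => by simpa [mul_comm] using h1 x hx y hy)
    (convex_halfSpace_ge (l y • l).isLinear 0) hx
  simpa [mul_comm] using this

end Faces

/-! ### Closures and faces of sign cones. -/

section SignCones

variable {V : Type*}

lemma mul_nonneg_of_conforms {x z : V → ℝ} (h : Conforms z x) (v : V) :
    0 ≤ (SignType.sign (x v) : ℝ) * z v := by
  rcases lt_trichotomy (z v) 0 with h1 | h1 | h1
  · have : x v < 0 := h.2 h1
    rw [sign_neg this]; simp; exact h1.le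
  · simp [h1]
  · have : 0 < x v := h.1 h1
    rw [sign_pos this]; simp; exact h1.le

lemma signCone_eq {L : Submodule ℝ (V → ℝ)} {x y : V → ℝ} (h1 : suppPos x = suppPos y)
    (h2 : suppNeg x = suppNeg y) : signCone L x = signCone L y := by
  unfold signCone
  rw [h1, h2]

lemma self_mem_signCone {L : Submodule ℝ (V → ℝ)} {x : V → ℝ} (hx : x ∈ L) : x ∈ signCone L x :=
  ⟨hx, rfl, rfl⟩

variable [Fintype V]

lemma isClosed_conforms {V : Type*} (x : V → ℝ) : IsClosed {z : V → ℝ | Conforms z x} := by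
  have : {z : V → ℝ | Conforms z x} =
      (⋂ v : V, ⋂ _ : ¬ 0 < x v, {z | z v ≤ 0}) ∩ ⋂ v : V, ⋂ _ : ¬ x v < 0, {z | 0 ≤ z v} := by
    ext z
    simp only [mem_inter_iff, mem_iInter]
    constructor
    · intro h
      exact ⟨fun v hv => not_lt.1 fun h' : 0 < z v => hv (h.1 h'), fun v hv =>
        not_lt.1 fun h' : z v < 0 => hv (h.2 h')⟩
    · rintro ⟨h1, h2⟩
      exact ⟨fun v hv => by_contra fun h' => not_lt.2 (show z v ≤ 0 from h1 v h') hv,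
        fun v hv => by_contra fun h' => not_lt.2 (show 0 ≤ z v from h2 v h') hv⟩
  rw [this]
  exact (isClosed_iInter fun v => isClosed_iInter fun _ =>
    isClosed_le (continuous_apply v) continuous_const).inter
    (isClosed_iInter fun v => isClosed_iInter fun _ =>
      isClosed_le continuous_const (continuous_apply v))

/-- A conforming `z` is the limit of `z + t • x` as `t` decreases to `0`, and these have the signs
of `x`. -/
lemma closure_signCone {L : Submodule ℝ (V → ℝ)} {x : V → ℝ} (hx : x ∈ L) :
    closure (signCone L x) = {z | z ∈ L ∧ Conforms z x} := by
  apply Subset.antisymm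
  · refine closure_minimal (fun z hz => ⟨hz.1, hz.2.1.subset, hz.2.2.subset⟩) ?_
    exact (L.closed_of_finiteDimensional).inter (isClosed_conforms x)
  · rintro z ⟨hz, hzx⟩
    have hlim : Filter.Tendsto (fun t : ℝ => z + t • x) (nhdsWithin 0 (Ioi 0)) (nhds z) := by
      have : Continuous fun t : ℝ => z + t • x := by fun_prop
      have h0 := this.tendsto 0
      simp only [zero_smul, add_zero] at h0
      exact h0.mono_left nhdsWithin_le_nhds
    refine mem_closure_of_tendsto hlim ?_
    filter_upwards [self_mem_nhdsWithin] with t ht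
    have ht : 0 < t := ht
    refine ⟨L.add_mem hz (L.smul_mem t hx), ?_, ?_⟩
    · ext v
      simp only [mem_suppPos, Pi.add_apply, Pi.smul_apply, smul_eq_mul]
      constructor
      · intro h
        by_contra hx'
        have h1 : ¬ 0 < z v := fun h' => hx' (hzx.1 h')
        have := mul_nonneg ht.le (sub_nonneg.2 (not_lt.1 hx'))
        linarith [not_lt.1 h1]
      · intro h
        have h1 : ¬ z v < 0 := fun h' => lt_asymm h (hzx.2 h')
        have := mul_pos ht h
        linarith [not_lt.1 h1]
    · ext v
      simp only [mem_suppNeg, Pi.add_apply, Pi.smul_apply, smul_eq_mul]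
      constructor
      · intro h
        by_contra hx'
        have h1 : ¬ z v < 0 := fun h' => hx' (hzx.2 h')
        have := mul_nonneg ht.le (not_lt.1 hx')
        linarith [not_lt.1 h1]
      · intro h
        have h1 : ¬ 0 < z v := fun h' => lt_asymm h (hzx.1 h')
        have := mul_pos_of_neg_of_neg (neg_lt_zero.2 ht) h
        linarith [not_lt.1 h1]

lemma Conforms.isOpenFace {L : Submodule ℝ (V → ℝ)} {x y : V → ℝ} (hx : x ∈ L) (hy : y ∈ L)
    (hxy : Conforms x y) : IsOpenFace (signCone L y) (signCone L x) := by
  classical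
  rw [IsOpenFace, closure_signCone hx, closure_signCone hy]
  refine ⟨fun _ => ?_, x, hx, Conforms.refl x⟩
  -- The supporting form is minus the sum of `|z v|` over the zeros of `x`, with signs read off from
  -- `y`; its maximum `0` is attained where `z` vanishes at these zeros.
  let c : V → ℝ := fun v => if x v = 0 then -(SignType.sign (y v) : ℝ) else 0
  let l : (V → ℝ) →L[ℝ] ℝ := ∑ v, c v • ContinuousLinearMap.proj v
  have hl : ∀ z, l z = ∑ v, c v * z v := fun z => by simp [l]
  have hterm : ∀ z, Conforms z y → ∀ v, c v * z v ≤ 0 := by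
    intro z hz v
    have := mul_nonneg_of_conforms hz v
    simp only [c]
    split_ifs
    · linarith
    · simp
  have hle : ∀ z, Conforms z y → l z ≤ 0 := fun z hz => by
    rw [hl]
    exact Finset.sum_nonpos fun v _ => hterm z hz v
  refine ⟨l, ?_⟩
  ext z
  constructor
  · rintro ⟨hz, hzx⟩
    refine ⟨⟨hz, hzx.trans hxy⟩, fun w hw => (hle w hw.2).trans ?_⟩
    rw [hl]
    refine (Finset.sum_eq_zero fun v _ => ?_).ge
    by_cases hv : x v = 0
    · have : z v = 0 := by
        by_contra h
        exact hzx.support_subset (show v ∈ Function.support z from h) hv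
      simp [this]
    · simp [c, hv]
  · rintro ⟨⟨hz, hzy⟩, hmax⟩
    have h0 : 0 ≤ l z := by
      have := hmax 0 ⟨L.zero_mem, by constructor <;> intro v hv <;> exact absurd hv (lt_irrefl (0 : ℝ))⟩
      simpa using this
    have hz0 : ∀ v, c v * z v = 0 := by
      have h1 : ∑ v, c v * z v = 0 := le_antisymm (by rw [← hl]; exact hle z hzy) (by rw [← hl]; exact h0)
      intro v
      exact (Finset.sum_eq_zero_iff_of_nonpos fun v _ => hterm z hzy v).1 h1 v (Finset.mem_univ v)
    have hxv : ∀ v, z v ≠ 0 → x v ≠ 0 := by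
      intro v hv hx0
      have := hz0 v
      simp only [c, hx0, if_true] at this
      rcases mul_eq_zero.1 this with h | h
      · have h2 : SignType.sign (y v) = 0 := by
          rcases lt_trichotomy (y v) 0 with h3 | h3 | h3
          · simp [sign_neg h3] at h
          · rw [h3, sign_zero]
          · simp [sign_pos h3] at h
        exact hzy.support_subset (show v ∈ Function.support z from hv) (sign_eq_zero_iff.1 h2)
      · exact hv h
    refine ⟨hz, fun v hv => ?_, fun v hv => ?_⟩
    · have hv' : 0 < z v := hv
      rcases lt_or_gt_of_ne (hxv v hv'.ne') with h | h
      · exact absurd (show y v < 0 from hxy.2 h) (lt_asymm (show 0 < y v from hzy.1 hv))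
      · exact h
    · have hv' : z v < 0 := hv
      rcases lt_or_gt_of_ne (hxv v hv'.ne) with h | h
      · exact h
      · exact absurd (show 0 < y v from hxy.1 h) (lt_asymm (show y v < 0 from hzy.2 hv))

end SignCones

/-! ### Consequences of coherence. -/

section Coherent

variable {V : Type*}

/-- The linear form `x_u - 2 s x_v` for a sign `s`. -/
def signForm (k : V × V × SignType) : (V → ℝ) →ₗ[ℝ] ℝ :=
  LinearMap.proj k.1 - (2 * (k.2.2 : ℝ)) • LinearMap.proj k.2.1

lemma signForm_apply (u v : V) (s : SignType) (x : V → ℝ) :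
    signForm (u, v, s) x = x u - 2 * s * x v := by simp [signForm]

/-- None of the forms `x_u - 2 s x_v` takes both signs on `F`. -/
def Coherent (F : Set (V → ℝ)) : Prop :=
  ∀ k : V × V × SignType, ∀ x ∈ F, ∀ y ∈ F, 0 ≤ signForm k x * signForm k y

variable {F : Set (V → ℝ)} {a e f : V → ℝ}

lemma Coherent.mul_nonneg (hF : Coherent F) (he : e ∈ F) (hf : f ∈ F) (v : V) : 0 ≤ e v * f v := by
  simpa [signForm_apply] using hF (v, v, 0) e he f hf

lemma conforms_of_support_subset (h : ∀ v, 0 ≤ e v * f v)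
    (hs : Function.support e ⊆ Function.support f) : Conforms e f := by
  constructor
  · intro v hv
    have hv' : 0 < e v := hv
    exact (nonneg_of_mul_nonneg_right (h v) hv').lt_of_ne (hs hv'.ne').symm
  · intro v hv
    have hv' : e v < 0 := hv
    have hne : f v ≠ 0 := hs hv'.ne
    refine lt_of_le_of_ne (not_lt.1 fun h' => ?_) hne
    have := mul_neg_of_neg_of_pos hv' h'
    linarith [h v]

/-- If `u` is only in the support of `e` and `v` only in that of `f`, the form with `s` the sign of
`e u * f v` has opposite signs at `e` and `f`. -/
lemma Coherent.conforms_or (hF : Coherent F) (he : e ∈ F) (hf : f ∈ F) :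
    Conforms e f ∨ Conforms f e := by
  by_cases h1 : Function.support e ⊆ Function.support f
  · exact Or.inl (conforms_of_support_subset (hF.mul_nonneg he hf) h1)
  by_cases h2 : Function.support f ⊆ Function.support e
  · exact Or.inr (conforms_of_support_subset (hF.mul_nonneg hf he) h2)
  obtain ⟨u, hu, hu'⟩ := not_subset.1 h1
  obtain ⟨v, hv, hv'⟩ := not_subset.1 h2
  have hu' : f u = 0 := by simpa using hu'
  have hv' : e v = 0 := by simpa using hv'
  have h3 := hF (u, v, SignType.sign (e u * f v)) e he f hf
  rw [signForm_apply, signForm_apply, hu', hv'] at h3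
  have h4 : (SignType.sign (e u * f v) : ℝ) * (e u * f v) = |e u * f v| := sign_mul_self _
  have h5 : 0 < |e u * f v| := abs_pos.2 (mul_ne_zero hu hv)
  nlinarith

/-- At `e` both forms `x_u ± 2 x_v` have the sign of `e u`, so neither may have the opposite sign at
`a`. -/
lemma Coherent.two_mul_abs_le (hF : Coherent F) (he : e ∈ F) (ha : a ∈ F) {u v : V} (hu : e u ≠ 0)
    (hv : e v = 0) : 2 * |a v| ≤ |a u| := by
  have h1 := hF (u, v, 1) e he a ha
  have h2 := hF (u, v, -1) e he a ha
  rw [signForm_apply, signForm_apply, hv] at h1 h2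
  simp only [SignType.coe_one, SignType.coe_neg, mul_zero, sub_zero] at h1 h2
  rcases lt_or_gt_of_ne hu with h | h
  · have h3 := nonpos_of_mul_nonneg_right h1 h
    have h4 := nonpos_of_mul_nonneg_right h2 h
    have h5 : |a v| ≤ -(a u) / 2 := abs_le.2 ⟨by linarith, by linarith⟩
    linarith [neg_le_abs (a u)]
  · have h3 := nonneg_of_mul_nonneg_right h1 h
    have h4 := nonneg_of_mul_nonneg_right h2 h
    have h5 : |a v| ≤ a u / 2 := abs_le.2 ⟨by linarith, by linarith⟩
    linarith [le_abs_self (a u)]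

/-- If `a` lies in a coherent set with `e` and in one with `f`, then `a` conforms to both `e` and
`f`, or one of `e` and `f` conforms to the other. -/
lemma Coherent.exists_common {T T' : Set (V → ℝ)} (hT : Coherent T) (hT' : Coherent T')
    (he : e ∈ T) (hf : f ∈ T') (haT : a ∈ T) (haT' : a ∈ T') :
    (Conforms a e ∧ Conforms a f) ∨ Conforms e f ∨ Conforms f e := by
  rcases hT.conforms_or haT he with h1 | h1 <;> rcases hT'.conforms_or haT' hf with h2 | h2
  · exact Or.inl ⟨h1, h2⟩
  · exact Or.inr (Or.inr (h2.trans h1))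
  · exact Or.inr (Or.inl (h1.trans h2))
  have hmul : ∀ v, 0 ≤ e v * f v := by
    intro v
    by_contra! h
    rcases mul_neg_iff.1 h with ⟨h3, h4⟩ | ⟨h3, h4⟩
    · exact lt_asymm (show 0 < a v from h1.1 h3) (h2.2 h4)
    · exact lt_asymm (show 0 < a v from h2.1 h4) (h1.2 h3)
  by_cases h3 : Function.support e ⊆ Function.support f
  · exact Or.inr (Or.inl (conforms_of_support_subset hmul h3))
  by_cases h4 : Function.support f ⊆ Function.support e
  · exact Or.inr (Or.inr (conforms_of_support_subset (fun v => by rw [mul_comm]; exact hmul v) h4))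
  obtain ⟨u, hu, hu'⟩ := not_subset.1 h3
  obtain ⟨v, hv, hv'⟩ := not_subset.1 h4
  -- Here `e` and `f` both conform to `a` with non-nested supports, and `|a u|` and `|a v|` would
  -- each be at least twice the other although `a u ≠ 0`.
  have h5 := hT.two_mul_abs_le he haT hu (by simpa using hv')
  have h6 := hT'.two_mul_abs_le hf haT' hv (by simpa using hu')
  have h7 : 0 < |a u| := abs_pos.2 (h1.support_subset hu)
  linarith [abs_nonneg (a v)]

lemma signCone_subset_of_openCone {L : Submodule ℝ (V → ℝ)} [Finite V] (hF : Coherent F)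
    (hFL : F ⊆ L) (he : e ∈ intrinsicInterior ℝ F) : openCone F ⊆ signCone L e := by
  have := Fintype.ofFinite V
  rintro _ ⟨r, hr, x, hx, rfl⟩
  have hpos : ∀ {x y : V → ℝ}, x ∈ intrinsicInterior ℝ F → y ∈ intrinsicInterior ℝ F → ∀ v,
      0 < x v → 0 < y v := fun hx hy v h =>
    sign_eq_of_mem_intrinsicInterior (l := LinearMap.proj v)
      (fun x hx y hy => hF.mul_nonneg hx hy v) hx hy h
  have hneg : ∀ {x y : V → ℝ}, x ∈ intrinsicInterior ℝ F → y ∈ intrinsicInterior ℝ F → ∀ v,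
      x v < 0 → y v < 0 := fun hx hy v h => by
    have := sign_eq_of_mem_intrinsicInterior (l := -(LinearMap.proj v : (V → ℝ) →ₗ[ℝ] ℝ))
      (fun x hx y hy => by simpa using hF.mul_nonneg hx hy v) hx hy (by simpa using h)
    simpa using this
  refine ⟨L.smul_mem r (hFL (intrinsicInterior_subset hx)), ?_, ?_⟩
  · ext v
    simp only [mem_suppPos, Pi.smul_apply, smul_eq_mul, mul_pos_iff_of_pos_left hr]
    exact ⟨hpos hx he v, hpos he hx v⟩
  · ext v
    simp only [mem_suppNeg, Pi.smul_apply, smul_neg_iff_of_pos_left hr]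
    exact ⟨hneg hx he v, hneg he hx v⟩

end Coherent

/-! ### Assembly of the polytopal representation. -/

section Main

variable {V : Type*} [Fintype V] {L : Submodule ℝ (V → ℝ)} {G : SimpleGraph V}

lemma IsCarrier.exists_mem {F α : Set (V → ℝ)} (h : IsCarrier L F α) (hF : Convex ℝ F)
    (hne : F.Nonempty) : ∃ e ∈ F, e ∈ L ∧ e ∈ α ∧ α = signCone L e := by
  obtain ⟨⟨x, hx, rfl⟩, hsub⟩ := h
  obtain ⟨e, he⟩ := hne.intrinsicInterior hF
  have hex := hsub he
  exact ⟨e, intrinsicInterior_subset he, hex.1, hex, signCone_eq hex.2.1.symm hex.2.2.symm⟩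

/-- A simplicial symmetric polytope in `L` with coherent proper faces represents `G`. -/
theorem isPolytopalRepresentation (hL : IsSemivalid G L) {ι : Type*} [Fintype ι] {p : ι → V → ℝ}
    (hp : IsSimplicialFamily p) (hpL : ∀ i, p i ∈ L)
    (h0 : (0 : L) ∈ interior (Subtype.val ⁻¹' convexHull ℝ (range p) : Set L))
    (hcoh : ∀ F, IsProperFace (convexHull ℝ (range p)) F → Coherent F)
    (hbd : ∀ x ∈ L, x ≠ 0 → ∃ (f : (V → ℝ) →ₗ[ℝ] ℝ) (r : ℝ), 0 < r ∧ (∀ i, f (p i) ≤ 1) ∧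
      f (r • x) = 1 ∧ r • x ∈ convexHull ℝ (range p)) :
    IsPolytopalRepresentation G L (convexHull ℝ (range p)) := by
  classical
  have hPL : convexHull ℝ (range p) ⊆ (L : Set (V → ℝ)) :=
    convexHull_min (by rintro _ ⟨i, rfl⟩; exact hpL i) L.convex
  have hFL : ∀ F, IsProperFace (convexHull ℝ (range p)) F → F ⊆ (L : Set (V → ℝ)) := by
    intro F hF x hx
    obtain ⟨l, hl⟩ := hF.1.1 hF.1.2
    rw [hl] at hx
    exact hPL hx.1
  have hFconv : ∀ F, IsProperFace (convexHull ℝ (range p)) F → Convex ℝ F := by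
    intro F hF
    obtain ⟨f, -, h, -⟩ := hp.exists_of_isProperFace hF
    rw [h]
    exact convex_convexHull ℝ _
  have hsubface : ∀ {H F : Set (V → ℝ)}, IsFace H F → F ⊆ H := by
    intro H F hF x hx
    obtain ⟨l, hl⟩ := hF.1 hF.2
    rw [hl] at hx
    exact hx.1
  refine ⟨⟨Finset.univ.image p, by simp⟩, hPL, h0, ?_, ⟨?_, ?_⟩, fun F hF => hp.isSimplex hF, ?_, ?_⟩
  · rintro a ⟨ha, l, hl⟩
    refine ⟨neg_mem_of_symm hp.symm ha, -l, fun y hy => ?_⟩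
    obtain ⟨h1, h2⟩ := hl (-y) (neg_mem_of_symm hp.symm hy)
    simp only [neg_apply, map_neg, neg_neg] at h1 h2 ⊢
    exact ⟨h1, fun h => neg_eq_iff_eq_neg.1 (h2 h)⟩
  · apply Subset.antisymm
    · rintro x ⟨α, rfl | ⟨F, hF, rfl⟩, hx⟩
      · rw [mem_singleton_iff] at hx
        subst hx
        exact ⟨_, ⟨0, L.zero_mem, rfl⟩, self_mem_signCone L.zero_mem⟩
      · obtain ⟨r, -, y, hy, rfl⟩ := hx
        have := L.smul_mem r (hFL F hF (intrinsicInterior_subset hy))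
        exact ⟨_, ⟨_, this, rfl⟩, self_mem_signCone this⟩
    · rintro x ⟨_, ⟨y, -, rfl⟩, hx⟩
      by_cases hx0 : x = 0
      · exact ⟨{0}, Or.inl rfl, hx0⟩
      · obtain ⟨f, r, hr, hf, hfx, hmem⟩ := hbd x hx.1 hx0
        obtain ⟨F, hF, hxF⟩ := hp.exists_isProperFace_mem hf hmem hfx
        refine ⟨openCone F, Or.inr ⟨F, hF, rfl⟩, r⁻¹, inv_pos.2 hr, _, hxF, ?_⟩
        rw [smul_smul, inv_mul_cancel₀ hr.ne', one_smul]
  · rintro η (rfl | ⟨F, hF, rfl⟩)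
    · exact ⟨_, ⟨0, L.zero_mem, rfl⟩, singleton_subset_iff.2 (self_mem_signCone L.zero_mem)⟩
    · obtain ⟨e, he⟩ := hF.1.2.intrinsicInterior (hFconv F hF)
      exact ⟨_, ⟨e, hFL F hF (intrinsicInterior_subset he), rfl⟩,
        signCone_subset_of_openCone (hcoh F hF) (hFL F hF) he⟩
  · intro E F H hE hF hH hEH hFH α β hα hβ
    obtain ⟨e, heE, heL, -, rfl⟩ := hα.exists_mem (hFconv E hE) hE.1.2
    obtain ⟨f, hfF, hfL, -, rfl⟩ := hβ.exists_mem (hFconv F hF) hF.1.2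
    rcases (hcoh H hH).conforms_or (hsubface hEH heE) (hsubface hFH hfF) with h | h
    · exact Or.inl (h.isOpenFace heL hfL)
    · exact Or.inr (h.isOpenFace hfL heL)
  · rintro a - E F hE hF ⟨-, T, hT, haT, hET⟩ ⟨-, T', hT', haT', hFT⟩ α β hα hβ hαc hβc
    obtain ⟨e, heE, heL, heα, rfl⟩ := hαc.exists_mem (hFconv E hE.1) hE.1.1.2
    obtain ⟨f, hfF, hfL, hfβ, rfl⟩ := hβc.exists_mem (hFconv F hF.1) hF.1.1.2
    have hbe := hα.2 e heα
    have hbf := hβ.2 f hfβ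
    have ha0 : a ≠ 0 := by
      rintro rfl
      obtain ⟨g, -, -, hg⟩ := hp.exists_of_isProperFace hT
      simpa using hg 0 haT
    -- The shared nonzero vector required by `broken_unique` is `a`, `e` or `f`, according to the
    -- case.
    have key : suppPos e = suppPos f ∧ suppNeg e = suppNeg f := by
      rcases (hcoh T hT).exists_common (hcoh T' hT') (hET heE) (hFT hfF) haT haT' with h | h | h
      · exact hL.broken_unique heL hbe hfL hbf (hFL T hT haT) ha0 h.1 h.2
      · exact hL.broken_unique heL hbe hfL hbf heL hbe.1 (Conforms.refl e) h
      · exact hL.broken_unique heL hbe hfL hbf hfL hbf.1 h (Conforms.refl f)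
    exact signCone_eq key.1 key.2

end Main

end Semivalid

theorem mainTheorem7 {V : Type*} [Finite V] (G : SimpleGraph V) (hG : G.Connected)
    (L : Submodule ℝ (V → ℝ)) (hL : Semivalid.IsSemivalid G L) :
    ∃ P : Set (V → ℝ), Semivalid.IsPolytopalRepresentation G L P := by
  classical
  have := Fintype.ofFinite V
  -- The construction runs inside `L`, with restricted forms, so that the origin is an interior
  -- point.
  obtain ⟨ι, _, q, hsym, hind, hsgn, hnhds⟩ := Semivalid.exists_simplicial_points
    (fun k : V × V × SignType => (Semivalid.signForm k).comp L.subtype) (fun x hx => by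
      ext v
      simpa [Semivalid.signForm_apply] using hx (v, v, 0))
  let p : ι → V → ℝ := fun i => (q i : V → ℝ)
  have himage : convexHull ℝ (Set.range p) = Subtype.val '' convexHull ℝ (Set.range q) := by
    have h1 := L.subtype.image_convexHull (Set.range q)
    rw [← Set.range_comp] at h1
    exact h1.symm
  have hp : Semivalid.IsSimplicialFamily p := by
    refine ⟨fun i => ?_, fun f hf c hc hs => ?_⟩
    · obtain ⟨j, hj⟩ := hsym i
      exact ⟨j, congrArg Subtype.val hj⟩
    · refine hind (f.comp L.subtype) hf c hc (Subtype.ext ?_)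
      simpa [p] using hs
  have hpre : (Subtype.val ⁻¹' convexHull ℝ (Set.range p) : Set L) = convexHull ℝ (Set.range q) := by
    rw [himage, Set.preimage_image_eq _ Subtype.val_injective]
  refine ⟨_, Semivalid.isPolytopalRepresentation hL hp (fun i => (q i).2) ?_ ?_ ?_⟩
  · rw [hpre]
    exact mem_interior_iff_mem_nhds.2 hnhds
  · intro F hF k
    obtain ⟨f, hf, rfl, -⟩ := hp.exists_of_isProperFace hF
    refine Semivalid.mul_nonneg_on_convexHull ?_
    rintro _ ⟨i, hi, rfl⟩ _ ⟨j, hj, rfl⟩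
    exact hsgn (f.comp L.subtype) hf k i j hi hj
  · intro x hx hx0
    obtain ⟨f, r, hr, hf, hfx, hmem⟩ := Semivalid.exists_supporting (convex_convexHull ℝ (Set.range q))
      ((Set.finite_range q).isCompact_convexHull ℝ) hnhds (x := ⟨x, hx⟩)
      (fun h => hx0 (congrArg Subtype.val h))
    -- Supporting forms on `L` are extended to the ambient space, where faces are taken.
    obtain ⟨g, hg⟩ := LinearMap.exists_extend f
    have hgv : ∀ y : L, g y = f y := fun y => LinearMap.congr_fun hg y
    refine ⟨g, r, hr, fun i => ?_, ?_, ?_⟩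
    · rw [show p i = (q i : V → ℝ) from rfl, hgv]
      exact hf _ (subset_convexHull ℝ _ ⟨i, rfl⟩)
    · rw [← hfx, ← hgv]
      rfl
    · rw [himage]
      exact ⟨_, hmem, rfl⟩
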